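/- Fix $\beta_0>0$. For $\mathbf q\in\mathbb R^3$ let $q^0=\sqrt{1+|\mathbf q|^2}$, $\hat q=\mathbf q/q^0$, and let $$J^0(\mathbf q)=\frac{e^{-\beta_0 q^0}}{M(\beta_0)},\quad M(\beta_0)=\int_{\mathbb R^3}e^{-\beta_0 q^0}\,d\mathbf q,\quad K_j(\beta)=\int_0^\infty\cosh(jr)\,e^{-\beta\cosh r}\,dr,$$ $$\alpha_0=\frac{K_1(\beta_0)}{K_2(\beta_0)},\qquad \Psi(\beta_0)=\frac3{\beta_0}+\alpha_0,\qquad \kappa_0=\frac{3\alpha_0}{\beta_0}+\alpha_0^2-1 .$$ For $f=f(\mathbf q)\in L^2(\mathbb R^3)$ put $h=\sqrt{J^0}f$ and $$P(f)=\Big[\frac{\alpha_0q^0-1}{\kappa_0}\int h\,d\mathbf p+\frac{\Psi(\beta_0)-q^0}{\kappa_0}\int h\,\frac{d\mathbf p}{p^0}+\beta_0\,\mathbf q\cdot\!\int \mathbf p\,h\,\frac{d\mathbf p}{p^0}\Big]\sqrt{J^0},\qquad Lf=\frac{P(f)-f}{q^0}.$$ Let $\hat f(\zeta,\mathbf q)=(2\pi)^{-3/2}\int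 e^{-i\zeta\cdot x}f(x,\mathbf q)\,dx$ be the partial Fourier transform in $x$ on $L^2(\mathbb R^3_x\times\mathbb R^3_{\mathbf q})$, and for real $l\ge0$ let $H_l=L^2(\mathbb R^3_{\mathbf q};H^l(\mathbb R^3_x))$ (complex-valued functions), with $$\|f\|_l^2=\int\|f(\cdot,\mathbf q)\|_{H^l(\mathbb R^3_x)}^2\,d\mathbf q=\iint(1+|\zeta|^2)^l\,|\hat f(\zeta,\mathbf q)|^2\,d\zeta\,d\mathbf q .$$ Let $\hat B(\zeta)=L-i\,\zeta\cdot\mathbf q/q^0$, a bounded operator on $L^2(\mathbb R^3_{\mathbf q})$ for each $\zeta\in\mathbb R^3$. A global weak solution of $$\partial_tf+\hat q\cdot\nabla_xf=Lf,\qquad f(0)=f_0,$$ is a map $t\mapsto f(t)\in L^2(\mathbb R^3_x\times\mathbb R^3_{\mathbf q})$, $t\ge0$, (Bochner) integrable on $[0,T]$ for every $T>0$, such that for every $t\ge0$ and every $\varphi\in C_c^\infty(\mathbb R^3_x\times\mathbb R^3_{\mathbf q})$ $$\iint f(t)\varphi=\iint f_0\varphi+\int_0^t\!\iint\big(f(s)\,\hat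 q\cdot\nabla_x\varphi+(Lf(s))\varphi\big)\,dx\,d\mathbf q\,ds .$$ **Theorem.** Let $l\ge0$ and $f_0\in H_l$. Then there exists a global weak solution $f$, and it is unique: every global weak solution with datum $f_0$ coincides with $f(t)$ for all $t\ge0$. Moreover: 1. $f(t)\in H_l$ and $\|f(t)\|_l\le\|f_0\|_l$ for all $t\ge0$; 2. $t\mapsto f(t)$ is continuous from $[0,\infty)$ to $H_l$; 3. $f(t)=e^{tB}f_0$, where $e^{tB}$ is given by partial Fourier transform: for every $t\ge0$ and a.e. $\zeta\in\mathbb R^3$, $\hat f(t,\zeta,\cdot)=e^{t\hat B(\zeta)}\hat f_0(\zeta,\cdot)$, and $\|\hat f(t,\zeta,\cdot)\|_{L^2(\mathbb R^3_{\mathbf q})}\le\|\hat f_0(\zeta,\cdot)\|_{L^2(\mathbb R^3_{\mathbf q})}$; 4. if $f_0$ is real-valued almost everywhere, then so is $f(t)$ for every $t\ge0$. -/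

import Mathlib

open MeasureTheory Filter Topology
open scoped FourierTransform ContDiff

namespace RelBGK

noncomputable section

/-- Three-dimensional Euclidean space: positions `x`, momenta `q`, and frequencies `ζ`. -/
abbrev E3 : Type := EuclideanSpace ℝ (Fin 3)

/-- `L²(ℝ³_q)`, complex valued. -/
abbrev L2q : Type := Lp ℂ 2 (volume : Measure E3)

/-- `L²(ℝ³_x × ℝ³_q)`, realised as `L²(ℝ³_x; L²(ℝ³_q))`: for `f : L2xq` the value at `(x, q)`
is `f x q`. -/
abbrev L2xq : Type := Lp L2q 2 (volume : Measure E3)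

/-! ### The linearized collision operator -/

/-- The relativistic energy `q⁰ = √(1 + |q|²)`. -/
def energy (q : E3) : ℝ := √(1 + ‖q‖ ^ 2)

/-- The relativistic velocity `q̂ = q / q⁰`. -/
def velocity (q : E3) : E3 := (energy q)⁻¹ • q

/-- The modified Bessel function `K_j(β) = ∫_0^∞ cosh(j r) exp(-β cosh r) dr`. -/
def besselK (j : ℕ) (β : ℝ) : ℝ :=
  ∫ r in Set.Ioi (0 : ℝ), Real.cosh (j * r) * Real.exp (-β * Real.cosh r)

/-- `M(β) = ∫ exp(-β √(1 + |q|²)) dq`. -/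
def normM (β : ℝ) : ℝ := ∫ q : E3, Real.exp (-β * energy q)

/-- The global Jüttner equilibrium `J⁰(q) = exp(-β q⁰) / M(β)`. -/
def juttner (β : ℝ) (q : E3) : ℝ := Real.exp (-β * energy q) / normM β

/-- `α₀ = K₁(β) / K₂(β)`. -/
def alphaZero (β : ℝ) : ℝ := besselK 1 β / besselK 2 β

/-- `Ψ(β) = 3 / β + K₁(β) / K₂(β)`. -/
def Psi (β : ℝ) : ℝ := 3 / β + besselK 1 β / besselK 2 β

/-- `κ₀ = 3 α₀ / β + α₀² - 1`. -/
def kappaZero (β : ℝ) : ℝ := 3 * alphaZero β / β + alphaZero β ^ 2 - 1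

/-- The operator `P`. With `h = √J⁰ f` it is
`P f = [ (α₀ q⁰ - 1)/κ₀ ∫ h dq + (Ψ(β) - q⁰)/κ₀ ∫ h dq/q⁰ + β (∫ q h dq/q⁰) · q ] √J⁰`. -/
def projP (β : ℝ) (f : E3 → ℂ) (q : E3) : ℂ :=
  ((((alphaZero β * energy q - 1) / kappaZero β : ℝ) : ℂ)
        * (∫ p : E3, (√(juttner β p) : ℂ) * f p)
    + (((Psi β - energy q) / kappaZero β : ℝ) : ℂ)
        * (∫ p : E3, ((√(juttner β p) / energy p : ℝ) : ℂ) * f p)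
    + (β : ℂ) * ∑ i : Fin 3, (q i : ℂ)
        * (∫ p : E3, ((p i * √(juttner β p) / energy p : ℝ) : ℂ) * f p))
    * (√(juttner β q) : ℂ)

/-- The linearized relativistic BGK operator `L f = (P f - f) / q⁰`. -/
def linL (β : ℝ) (f : E3 → ℂ) (q : E3) : ℂ := (projP β f q - f q) / (energy q : ℂ)

/-! ### Weak solutions -/

/-- `f` is a global weak solution in `L²(ℝ³_x × ℝ³_q)` of `∂_t f + q̂ · ∇_x f = L f`,
`f(0) = f₀`: it is locally integrable on `[0, ∞)` with values in `L²` and, for all `t ≥ 0` and all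
test functions `φ ∈ C_c^∞(ℝ³_x × ℝ³_q)`,
`∬ f(t) φ = ∬ f₀ φ + ∫_0^t ∬ ( f(s) (q̂ · ∇_x φ) + (L f(s)) φ ) ds`. -/
def IsWeakSolution (β : ℝ) (f₀ : L2xq) (f : ℝ → L2xq) : Prop :=
  (∀ T : ℝ, 0 < T → IntegrableOn f (Set.Icc 0 T) volume) ∧
  ∀ φ : E3 × E3 → ℂ, ContDiff ℝ ∞ φ → HasCompactSupport φ → ∀ t : ℝ, 0 ≤ t →
    (∫ x, ∫ q, f t x q * φ (x, q)) =
      (∫ x, ∫ q, f₀ x q * φ (x, q)) +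
        ∫ s in (0 : ℝ)..t, ∫ x, ∫ q,
          (f s x q * fderiv ℝ φ (x, q) (velocity q, 0) + linL β (f s x) q * φ (x, q))

/-! ### The partial Fourier transform and the spaces `H_l` -/

/-- The partial Fourier transform in `x`,
`f̂(ζ, q) = (2π)^{-3/2} ∫ exp(-i ζ·x) f(x, q) dx`, extended to `L²` by Plancherel.
(Mathlib's transform is `𝓕 f (ξ) = ∫ exp(-2π i ξ·x) f(x) dx`, so `ξ = ζ / 2π`.) -/
def partialFourier (f : L2xq) (ζ : E3) : L2q :=
  (((2 * Real.pi) ^ (-(3 / 2 : ℝ)) : ℝ) : ℂ) • (𝓕 f : L2xq) ((2 * Real.pi)⁻¹ • ζ)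

/-- The norm of `H_l = L²(ℝ³_q; H^l(ℝ³_x))`, with value `∞` outside `H_l`:
`‖f‖_l² = ∫ ‖f(·, q)‖²_{H^l} dq = ∬ (1 + |ζ|²)^l |f̂(ζ, q)|² dq dζ`. -/
def HlNorm (l : ℝ) (f : L2xq) : ENNReal :=
  eLpNorm (fun ζ : E3 => (1 + ‖ζ‖ ^ 2) ^ (l / 2) * ‖partialFourier f ζ‖) 2 volume

/-- Membership in `H_l`, as a subspace of `L²(ℝ³_x × ℝ³_q)`. -/
def MemHl (l : ℝ) (f : L2xq) : Prop := HlNorm l f < ⊤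

/-! ### The operators `B̂(ζ) = L - i ζ·q / q⁰` on `L²(ℝ³_q)` -/

theorem one_le_energy (q : E3) : 1 ≤ energy q := by
  unfold energy
  rw [Real.one_le_sqrt]
  nlinarith [sq_nonneg ‖q‖]

theorem energy_pos (q : E3) : 0 < energy q := lt_of_lt_of_le one_pos (one_le_energy q)

theorem norm_le_energy (q : E3) : ‖q‖ ≤ energy q := by
  unfold energy
  apply Real.le_sqrt_of_sq_le
  linarith

theorem energy_le (q : E3) : energy q ≤ 1 + ‖q‖ := by
  unfold energy
  rw [Real.sqrt_le_left (by positivity)]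
  nlinarith [norm_nonneg q]

theorem abs_coord_le (q : E3) (i : Fin 3) : |q i| ≤ energy q := by
  have h := PiLp.norm_apply_le q i
  rw [Real.norm_eq_abs] at h
  exact h.trans (norm_le_energy q)

@[fun_prop]
theorem continuous_energy : Continuous energy := by
  unfold energy
  fun_prop

@[fun_prop]
theorem continuous_juttner (β : ℝ) : Continuous (juttner β) := by
  unfold juttner
  fun_prop

/-- The weight `q⁰ √J⁰` is square integrable. -/
theorem memLp_energy_mul {β : ℝ} (hβ : 0 < β) :
    MemLp (fun q : E3 => energy q * √(juttner β q)) 2 volume := by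
  set C : ℝ := (48 / β ^ 3 * Real.exp (β / 2)) / √(normM β) with hC
  have h1 : MemLp (fun q : E3 => C * (1 + ‖q‖) ^ (-(2 : ℝ))) 2 volume := by
    apply MemLp.const_mul
    rw [memLp_two_iff_integrable_sq]
    · have h := integrable_one_add_norm (E := E3) (μ := volume) (r := 4)
        (by simp; norm_num)
      refine h.congr (Eventually.of_forall fun q => ?_)
      have hp : 0 < 1 + ‖q‖ := by positivity
      simp only
      rw [← Real.rpow_natCast, ← Real.rpow_mul hp.le]
      norm_num
    · apply Continuous.aestronglyMeasurable
      apply Continuous.rpow_const (by fun_prop)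
      intro q
      left
      positivity
  refine h1.of_le (Continuous.aestronglyMeasurable (by fun_prop)) (Eventually.of_forall fun q => ?_)
  have hp : 0 < 1 + ‖q‖ := by positivity
  rw [Real.norm_eq_abs, Real.norm_eq_abs, abs_of_nonneg
    (mul_nonneg (energy_pos q).le (Real.sqrt_nonneg _))]
  refine le_trans ?_ (le_abs_self _)
  have hs : √(juttner β q) = Real.exp (-β * energy q / 2) / √(normM β) := by
    unfold juttner
    rw [Real.sqrt_div (Real.exp_pos _).le, Real.exp_half]
  have hexp : (β / 2 * (1 + ‖q‖)) ^ 3 / 6 ≤ Real.exp (β / 2 * (1 + ‖q‖)) := by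
    have := Real.pow_div_factorial_le_exp (β / 2 * (1 + ‖q‖)) (by positivity) 3
    simpa [Nat.factorial] using this
  have hmono : Real.exp (-β * energy q / 2) ≤ Real.exp (-(β / 2 * (1 + ‖q‖)) + β / 2) := by
    apply Real.exp_le_exp.2
    nlinarith [norm_le_energy q]
  have hmain : energy q * Real.exp (-β * energy q / 2)
      ≤ (48 / β ^ 3 * Real.exp (β / 2)) * (1 + ‖q‖) ^ (-(2 : ℝ)) := by
    calc energy q * Real.exp (-β * energy q / 2)
        ≤ (1 + ‖q‖) * Real.exp (-(β / 2 * (1 + ‖q‖)) + β / 2) := by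
          gcongr
          exact energy_le q
      _ ≤ _ := by
          rw [Real.exp_add, Real.exp_neg, Real.rpow_neg hp.le, Real.rpow_ofNat]
          rw [show (1 + ‖q‖) * ((Real.exp (β / 2 * (1 + ‖q‖)))⁻¹ * Real.exp (β / 2))
            = ((1 + ‖q‖) * Real.exp (β / 2)) / Real.exp (β / 2 * (1 + ‖q‖)) by
              field_simp]
          rw [div_le_iff₀ (Real.exp_pos _)]
          calc (1 + ‖q‖) * Real.exp (β / 2)
              = (48 / β ^ 3 * Real.exp (β / 2) * ((1 + ‖q‖) ^ 2)⁻¹)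
                  * ((β / 2 * (1 + ‖q‖)) ^ 3 / 6) := by
                field_simp
                ring
            _ ≤ _ := by gcongr
  rw [hs, hC]
  calc energy q * (Real.exp (-β * energy q / 2) / √(normM β))
      = (energy q * Real.exp (-β * energy q / 2)) / √(normM β) := by ring
    _ ≤ ((48 / β ^ 3 * Real.exp (β / 2)) * (1 + ‖q‖) ^ (-(2 : ℝ))) / √(normM β) := by
        gcongr
    _ = _ := by ring

/-- A continuous weight times `√J⁰` is square integrable if the weight is `O(q⁰)`. -/
theorem memLp_weight {β : ℝ} (hβ : 0 < β) (w : E3 → ℝ) (hw : Continuous w) (C : ℝ)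
    (hC : ∀ q, |w q| ≤ C * energy q) :
    MemLp (fun q : E3 => ((w q * √(juttner β q) : ℝ) : ℂ)) 2 volume := by
  refine ((memLp_energy_mul hβ).const_mul C).of_le
    (Continuous.aestronglyMeasurable (by fun_prop)) (Eventually.of_forall fun q => ?_)
  rw [Complex.norm_real, Real.norm_eq_abs, Real.norm_eq_abs, abs_mul,
    abs_of_nonneg (Real.sqrt_nonneg _)]
  refine le_trans ?_ (le_abs_self _)
  rw [← mul_assoc]
  exact mul_le_mul_of_nonneg_right (hC q) (Real.sqrt_nonneg _)

/-- The weights entering `P / q⁰`: output weights first, then the weights in the integrals. -/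
def outWeight (β : ℝ) : Fin 3 ⊕ Fin 2 → E3 → ℝ
  | .inl i, q => β * q i / energy q
  | .inr 0, q => (alphaZero β * energy q - 1) / kappaZero β / energy q
  | .inr 1, q => (Psi β - energy q) / kappaZero β / energy q

def inWeight : Fin 3 ⊕ Fin 2 → E3 → ℝ
  | .inl i, q => q i / energy q
  | .inr 0, _ => 1
  | .inr 1, q => 1 / energy q

theorem memLp_outWeight {β : ℝ} (hβ : 0 < β) (j : Fin 3 ⊕ Fin 2) :
    MemLp (fun q : E3 => ((outWeight β j q * √(juttner β q) : ℝ) : ℂ)) 2 volume := by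
  have hne : ∀ q, energy q ≠ 0 := fun q => (energy_pos q).ne'
  rcases j with i | j
  · refine memLp_weight hβ _ (by unfold outWeight; fun_prop (disch := exact hne _)) β fun q => ?_
    have h0 := energy_pos q
    rw [outWeight, abs_div, abs_mul, abs_of_pos hβ, abs_of_pos h0, div_le_iff₀ h0]
    nlinarith [mul_le_mul_of_nonneg_left (abs_coord_le q i) hβ.le,
      mul_pos hβ h0, one_le_energy q, mul_le_mul_of_nonneg_left (one_le_energy q)
        (mul_pos hβ h0).le]
  · have key : ∀ a b : ℝ, ∀ q, |(a * energy q + b) / kappaZero β / energy q|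
        ≤ ((|a| + |b|) / |kappaZero β|) * energy q := by
      intro a b q
      have h1 := one_le_energy q
      have h0 := energy_pos q
      rw [abs_div, abs_div, abs_of_pos h0, div_mul_eq_mul_div, div_right_comm]
      gcongr
      rw [div_le_iff₀ h0]
      calc |a * energy q + b| ≤ |a * energy q| + |b| := abs_add_le _ _
        _ = |a| * energy q + |b| := by rw [abs_mul, abs_of_pos h0]
        _ ≤ (|a| + |b|) * energy q := by nlinarith [abs_nonneg b]
        _ ≤ (|a| + |b|) * energy q * energy q := by
          nlinarith [mul_nonneg (add_nonneg (abs_nonneg a) (abs_nonneg b)) h0.le]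
    fin_cases j
    · refine memLp_weight hβ _ (by
        change Continuous fun q => (alphaZero β * energy q - 1) / kappaZero β / energy q
        fun_prop (disch := exact hne _))
        ((|alphaZero β| + |-1|) / |kappaZero β|)
        fun q => ?_
      have := key (alphaZero β) (-1) q
      simpa [outWeight, sub_eq_add_neg] using this
    · refine memLp_weight hβ _ (by
        change Continuous fun q => (Psi β - energy q) / kappaZero β / energy q
        fun_prop (disch := exact hne _)) ((|-1| + |Psi β|) / |kappaZero β|)
        fun q => ?_
      have := key (-1) (Psi β) q
      simpa [outWeight, sub_eq_add_neg, add_comm] using this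

theorem memLp_inWeight {β : ℝ} (hβ : 0 < β) (j : Fin 3 ⊕ Fin 2) :
    MemLp (fun q : E3 => ((inWeight j q * √(juttner β q) : ℝ) : ℂ)) 2 volume := by
  have hne : ∀ q, energy q ≠ 0 := fun q => (energy_pos q).ne'
  rcases j with i | j
  · refine memLp_weight hβ _ (by unfold inWeight; fun_prop (disch := exact hne _)) 1 fun q => ?_
    have h0 := energy_pos q
    rw [inWeight, abs_div, abs_of_pos h0, div_le_iff₀ h0, one_mul]
    nlinarith [abs_coord_le q i, one_le_energy q]
  · fin_cases j
    · refine memLp_weight hβ _ (by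
        change Continuous fun _ : E3 => (1 : ℝ)
        fun_prop) 1 fun q => ?_
      simpa [inWeight] using one_le_energy q
    · refine memLp_weight hβ _ (by
        change Continuous fun q : E3 => 1 / energy q
        fun_prop (disch := exact hne _)) 1
        fun q => ?_
      have h0 := energy_pos q
      simp only [inWeight]
      rw [abs_div, abs_one, abs_of_pos h0, div_le_iff₀ h0, one_mul]
      nlinarith [one_le_energy q]

/-- The multiplier `(1 + i ζ·q) / q⁰`. -/
def multiplier (ζ q : E3) : ℂ := (1 + Complex.I * (inner ℝ ζ q : ℝ)) / (energy q : ℂ)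

theorem memLp_multiplier (ζ : E3) : MemLp (multiplier ζ) ⊤ (volume : Measure E3) := by
  have hc : Continuous (multiplier ζ) := by
    unfold multiplier
    have hne : ∀ q, (energy q : ℂ) ≠ 0 := fun q => by exact_mod_cast (energy_pos q).ne'
    fun_prop (disch := exact hne _)
  refine memLp_top_of_bound hc.aestronglyMeasurable (1 + ‖ζ‖) (Eventually.of_forall fun q => ?_)
  have h0 := energy_pos q
  rw [multiplier, norm_div, Complex.norm_real, Real.norm_eq_abs, abs_of_pos h0, div_le_iff₀ h0]
  calc ‖1 + Complex.I * ((inner ℝ ζ q : ℝ) : ℂ)‖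
      ≤ ‖(1 : ℂ)‖ + ‖Complex.I * ((inner ℝ ζ q : ℝ) : ℂ)‖ := norm_add_le _ _
    _ = 1 + |inner ℝ ζ q| := by simp
    _ ≤ 1 + ‖ζ‖ * ‖q‖ := by gcongr; exact abs_real_inner_le_norm ζ q
    _ ≤ (1 + ‖ζ‖) * energy q := by
      nlinarith [one_le_energy q, mul_le_mul_of_nonneg_left (norm_le_energy q) (norm_nonneg ζ)]

/-- The bounded operator `B̂(ζ) = L - i ζ·q / q⁰` on `L²(ℝ³_q)`, as a sum of rank-one operators
and a multiplication operator; `fiberGenerator_coeFn` gives it pointwise. -/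
def fiberGenerator (β : ℝ) (hβ : 0 < β) (ζ : E3) : L2q →L[ℂ] L2q :=
  ∑ j : Fin 3 ⊕ Fin 2,
      (innerSL ℂ ((memLp_inWeight hβ j).toLp _ : L2q)).smulRight
        ((memLp_outWeight hβ j).toLp _ : L2q)
    - (ContinuousLinearMap.mul ℂ ℂ).holderL (volume : Measure E3) ⊤ 2 2
        ((memLp_multiplier ζ).toLp _)

/-- For every `f ∈ L²(ℝ³_q)`: `(B̂(ζ) f)(q) = (L f)(q) - i (ζ·q / q⁰) f(q)`. -/
theorem fiberGenerator_coeFn (β : ℝ) (hβ : 0 < β) (ζ : E3) (f : L2q) :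
    (fiberGenerator β hβ ζ f : E3 → ℂ) =ᵐ[volume] fun q =>
      linL β f q - Complex.I * (inner ℝ ζ (velocity q) : ℝ) * f q := by
  have hin : ∀ j, (inner ℂ ((memLp_inWeight hβ j).toLp _ : L2q) f : ℂ)
      = ∫ p : E3, ((inWeight j p * √(juttner β p) : ℝ) : ℂ) * f p := by
    intro j
    rw [L2.inner_def]
    apply integral_congr_ae
    filter_upwards [(memLp_inWeight hβ j).coeFn_toLp] with p hp
    rw [hp, RCLike.inner_apply, mul_comm, Complex.conj_ofReal]
  set c : Fin 3 ⊕ Fin 2 → ℂ := fun j =>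
    ∫ p : E3, ((inWeight j p * √(juttner β p) : ℝ) : ℂ) * f p with hc
  have hexp : fiberGenerator β hβ ζ f
      = (c (.inl 0) • ((memLp_outWeight hβ (.inl 0)).toLp _ : L2q)
        + c (.inl 1) • ((memLp_outWeight hβ (.inl 1)).toLp _ : L2q)
        + c (.inl 2) • ((memLp_outWeight hβ (.inl 2)).toLp _ : L2q)
        + (c (.inr 0) • ((memLp_outWeight hβ (.inr 0)).toLp _ : L2q)
        + c (.inr 1) • ((memLp_outWeight hβ (.inr 1)).toLp _ : L2q)))
        - (ContinuousLinearMap.mul ℂ ℂ).holder 2 ((memLp_multiplier ζ).toLp _) f := by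
    simp only [fiberGenerator, sub_apply,
      Fintype.sum_sum_type, Fin.sum_univ_three, Fin.sum_univ_two,
      add_apply, ContinuousLinearMap.smulRight_apply, innerSL_apply_apply,
      hin, hc]
    rfl
  rw [hexp]
  have e (j) := (memLp_outWeight hβ j).coeFn_toLp
  have s (j) := Lp.coeFn_smul (c j) ((memLp_outWeight hβ j).toLp _ : L2q)
  filter_upwards [Lp.coeFn_sub (c (.inl 0) • ((memLp_outWeight hβ (.inl 0)).toLp _ : L2q)
        + c (.inl 1) • ((memLp_outWeight hβ (.inl 1)).toLp _ : L2q)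
        + c (.inl 2) • ((memLp_outWeight hβ (.inl 2)).toLp _ : L2q)
        + (c (.inr 0) • ((memLp_outWeight hβ (.inr 0)).toLp _ : L2q)
        + c (.inr 1) • ((memLp_outWeight hβ (.inr 1)).toLp _ : L2q)))
        ((ContinuousLinearMap.mul ℂ ℂ).holder 2 ((memLp_multiplier ζ).toLp _) f),
    Lp.coeFn_add (c (.inl 0) • ((memLp_outWeight hβ (.inl 0)).toLp _ : L2q)
        + c (.inl 1) • ((memLp_outWeight hβ (.inl 1)).toLp _ : L2q)
        + c (.inl 2) • ((memLp_outWeight hβ (.inl 2)).toLp _ : L2q))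
        (c (.inr 0) • ((memLp_outWeight hβ (.inr 0)).toLp _ : L2q)
        + c (.inr 1) • ((memLp_outWeight hβ (.inr 1)).toLp _ : L2q)),
    Lp.coeFn_add (c (.inl 0) • ((memLp_outWeight hβ (.inl 0)).toLp _ : L2q)
        + c (.inl 1) • ((memLp_outWeight hβ (.inl 1)).toLp _ : L2q))
        (c (.inl 2) • ((memLp_outWeight hβ (.inl 2)).toLp _ : L2q)),
    Lp.coeFn_add (c (.inl 0) • ((memLp_outWeight hβ (.inl 0)).toLp _ : L2q))
        (c (.inl 1) • ((memLp_outWeight hβ (.inl 1)).toLp _ : L2q)),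
    Lp.coeFn_add (c (.inr 0) • ((memLp_outWeight hβ (.inr 0)).toLp _ : L2q))
        (c (.inr 1) • ((memLp_outWeight hβ (.inr 1)).toLp _ : L2q)),
    s (.inl 0), s (.inl 1), s (.inl 2), s (.inr 0), s (.inr 1),
    e (.inl 0), e (.inl 1), e (.inl 2), e (.inr 0), e (.inr 1),
    (ContinuousLinearMap.mul ℂ ℂ).coeFn_holder (r := 2) ((memLp_multiplier ζ).toLp _) f,
    (memLp_multiplier ζ).coeFn_toLp]
    with q h1 h2 h3 h4 h5 s1 s2 s3 s4 s5 e1 e2 e3 e4 e5 h6 h7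
  rw [h1, Pi.sub_apply, h2, Pi.add_apply, h3, Pi.add_apply, h4, h5, Pi.add_apply, Pi.add_apply,
    s1, s2, s3, s4, s5, h6, h7]
  simp only [Pi.smul_apply, e1, e2, e3, e4, e5, smul_eq_mul, ContinuousLinearMap.mul_apply']
  have hne : (energy q : ℂ) ≠ 0 := by exact_mod_cast (energy_pos q).ne'
  have c0 : ∀ i, c (.inl i)
      = ∫ p : E3, ((p i * √(juttner β p) / energy p : ℝ) : ℂ) * f p := by
    intro i
    simp only [hc, inWeight]
    congr 1
    ext p
    push_cast
    ring
  have c1 : c (.inr 0) = ∫ p : E3, (√(juttner β p) : ℂ) * f p := by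
    simp [hc, inWeight]
  have c2 : c (.inr 1) = ∫ p : E3, ((√(juttner β p) / energy p : ℝ) : ℂ) * f p := by
    simp only [hc, inWeight]
    congr 1
    ext p
    push_cast
    ring
  simp only [linL, projP, Fin.sum_univ_three, ← c0, ← c1, ← c2, outWeight, multiplier, velocity,
    real_inner_smul_right]
  push_cast
  field_simp
  ring

end

end RelBGK

namespace RelBGK

open scoped SchwartzMap LineDeriv

/-! ### Moments of the Jüttner equilibrium -/

/-! The Fourier transform in `x` decouples the equation into the linear equations `∂_t f̂ = B̂(ζ)
f̂` on `L²(ℝ³_q)`, one for each frequency, with bounded generators. Everything rests on `Re ⟨v,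
B̂(ζ) v⟩ ≤ 0` (`re_inner_fiberGenerator_nonpos`). The transport part is skew. For the collision part
put `u = v / √q⁰`: then `Re ⟨v, L v⟩ = Re ⟨u, Π u⟩ - ‖u‖²`, where `Π` is built from the vectors
`√(q⁰ J⁰) · {qᵢ/q⁰, 1, 1/q⁰}` with the inverse of their Gram matrix as coefficients. The Gram matrix
is block diagonal, with blocks `β⁻¹ I₃` and `(Ψ 1; 1 α₀)`, the latter of determinant `κ₀`; its
entries follow from Bessel-function moments and from the symmetries of `J⁰`. So `Π` is an orthogonal
projection and Bessel's inequality concludes (`re_gram_form_le_norm_sq`).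

Hence `e^{tB̂(ζ)}` is a contraction for every `ζ`. This bounds every weighted norm at once and
supplies the dominating functions for strong continuity (`tendsto_eLpNorm_propagator`) and for
differentiating the pairing with a test function (`hasDerivAt_inner_evol`). The growth of `B̂(ζ)` in
`ζ` is harmless there, because each factor `ζᵢ` falls on the test function as a derivative.

For uniqueness let `w` be the difference of two weak solutions and `Y(t) = ∫₀ᵗ w`. The weak
formulation says `w = B Y`, so `ŵ(t, ζ) = B̂(ζ) Ŷ(t, ζ)` almost everywhere
(`fourier_eq_fiberGenerator_of_weakForm`). On a ball of frequencies the generators are uniformly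
bounded, and Gronwall's inequality gives `Ŷ = 0`, hence `ŵ = 0`, at every time
(`map_integral_eq_zero`). Reality follows from uniqueness, since the equation has real coefficients.

Frequencies `ξ` of `𝓕` are related to those of the statement by `ζ = 2πξ`. -/

theorem cosh_pow_mul_exp_le {β : ℝ} (hβ : 0 < β) (n : ℕ) {r : ℝ} (hr : 0 ≤ r) :
    Real.cosh r ^ n * Real.exp (-β * Real.cosh r)
      ≤ (n.factorial / (β / 2) ^ n) * Real.exp (-(β / 2) * r) := by
  have hc : 0 < Real.cosh r := Real.cosh_pos r
  have hexp := Real.pow_div_factorial_le_exp (β / 2 * Real.cosh r) (by positivity) n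
  have hrc : r ≤ Real.cosh r := by
    have h1 : r ≤ Real.sinh r := Real.self_le_sinh_iff.2 hr
    exact h1.trans (Real.sinh_lt_cosh r).le
  have h2 : Real.exp (-(β / 2) * Real.cosh r) ≤ Real.exp (-(β / 2) * r) := by
    apply Real.exp_le_exp.2
    nlinarith
  have h3 : Real.cosh r ^ n * Real.exp (-(β / 2) * Real.cosh r) ≤ n.factorial / (β / 2) ^ n := by
    rw [neg_mul, Real.exp_neg, ← div_eq_mul_inv, div_le_div_iff₀ (Real.exp_pos _) (by positivity)]
    rw [mul_pow, div_le_iff₀ (by positivity)] at hexp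
    nlinarith
  calc Real.cosh r ^ n * Real.exp (-β * Real.cosh r)
      = (Real.cosh r ^ n * Real.exp (-(β / 2) * Real.cosh r))
        * Real.exp (-(β / 2) * Real.cosh r) := by
        rw [mul_assoc, ← Real.exp_add]; ring_nf
    _ ≤ _ := by gcongr

theorem integrableOn_sinh_cosh {β : ℝ} (hβ : 0 < β) (m n : ℕ) :
    IntegrableOn (fun r : ℝ => Real.sinh r ^ m * Real.cosh r ^ n * Real.exp (-β * Real.cosh r))
      (Set.Ioi 0) := by
  refine Integrable.mono' ((exp_neg_integrableOn_Ioi 0 (half_pos hβ)).const_mul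
    (((m + n).factorial : ℝ) / (β / 2) ^ (m + n))) (by fun_prop) ?_
  filter_upwards [ae_restrict_mem measurableSet_Ioi] with r hr
  have hr' : 0 ≤ r := (Set.mem_Ioi.1 hr).le
  have hs : 0 ≤ Real.sinh r := Real.sinh_nonneg_iff.2 hr'
  rw [Real.norm_eq_abs, abs_of_nonneg (by positivity)]
  refine le_trans ?_ (cosh_pow_mul_exp_le hβ (m + n) hr')
  rw [pow_add]
  gcongr
  exact (Real.sinh_lt_cosh r).le

theorem tendsto_sinh_cosh {β : ℝ} (hβ : 0 < β) (n : ℕ) :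
    Tendsto (fun r : ℝ => Real.sinh r * Real.cosh r ^ n * Real.exp (-β * Real.cosh r))
      atTop (𝓝 0) := by
  have h : Tendsto (fun r : ℝ => (((n + 1).factorial : ℝ) / (β / 2) ^ (n + 1))
      * Real.exp (-(β / 2) * r)) atTop (𝓝 0) := by
    have := (Real.tendsto_exp_atBot.comp
      (tendsto_id.const_mul_atTop_of_neg (neg_lt_zero.2 (half_pos hβ)))).const_mul
        (((n + 1).factorial : ℝ) / (β / 2) ^ (n + 1))
    simpa using this
  refine squeeze_zero' ?_ ?_ h
  · filter_upwards [eventually_ge_atTop 0] with r hr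
    have hs : 0 ≤ Real.sinh r := Real.sinh_nonneg_iff.2 hr
    positivity
  · filter_upwards [eventually_ge_atTop 0] with r hr
    refine le_trans ?_ (cosh_pow_mul_exp_le hβ (n + 1) hr)
    rw [pow_succ']
    gcongr
    exact (Real.sinh_lt_cosh r).le

/-- The moments `∫ sinh² r coshⁿ r exp(-β cosh r) dr`. -/
noncomputable def sinhMoment (β : ℝ) (n : ℕ) : ℝ :=
  ∫ r in Set.Ioi (0 : ℝ), Real.sinh r ^ 2 * Real.cosh r ^ n * Real.exp (-β * Real.cosh r)

/-- Integration by parts: the derivative of `sinh r coshⁿ r exp(-β cosh r)` has integral zero, since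
`sinh 0 = 0` and the exponential wins at infinity. The truncated exponent `n - 1` is harmless at `n
= 0`, where its coefficient `n` vanishes. -/
theorem mul_sinhMoment {β : ℝ} (hβ : 0 < β) (n : ℕ) :
    β * sinhMoment β n = ∫ r in Set.Ioi (0 : ℝ),
      (Real.cosh r ^ (n + 1) + n * Real.sinh r ^ 2 * Real.cosh r ^ (n - 1))
        * Real.exp (-β * Real.cosh r) := by
  have hi (m k : ℕ) := integrableOn_sinh_cosh hβ m k
  have hderiv : ∀ r ∈ Set.Ici (0 : ℝ), HasDerivAt
      (fun r : ℝ => Real.sinh r * Real.cosh r ^ n * Real.exp (-β * Real.cosh r))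
      ((Real.cosh r ^ (n + 1) + n * Real.sinh r ^ 2 * Real.cosh r ^ (n - 1))
        * Real.exp (-β * Real.cosh r)
        - β * (Real.sinh r ^ 2 * Real.cosh r ^ n * Real.exp (-β * Real.cosh r))) r := by
    intro r _
    have h := ((Real.hasDerivAt_sinh r).mul ((Real.hasDerivAt_cosh r).pow n)).mul
      (((Real.hasDerivAt_cosh r).const_mul (-β)).exp)
    convert! h using 1
    simp only [Pi.mul_apply, Pi.pow_apply]
    ring
  have h1 : IntegrableOn (fun r : ℝ =>
      (Real.cosh r ^ (n + 1) + n * Real.sinh r ^ 2 * Real.cosh r ^ (n - 1))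
        * Real.exp (-β * Real.cosh r)) (Set.Ioi 0) := by
    have := (hi 0 (n + 1)).add ((hi 2 (n - 1)).const_mul (n : ℝ))
    refine this.congr (Eventually.of_forall fun r => ?_)
    simp only [Pi.add_apply, pow_zero]
    ring
  have h2 := (hi 2 n).const_mul β
  have key := integral_Ioi_of_hasDerivAt_of_tendsto' hderiv (h1.sub h2) (tendsto_sinh_cosh hβ n)
  rw [integral_sub h1 h2, integral_const_mul] at key
  simp only [Real.sinh_zero, zero_mul, sub_zero] at key
  rw [sinhMoment]
  linarith

theorem sinhMoment_zero {β : ℝ} (hβ : 0 < β) : sinhMoment β 0 = besselK 1 β / β := by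
  rw [eq_div_iff hβ.ne', mul_comm, mul_sinhMoment hβ, besselK]
  simp

theorem sinhMoment_one {β : ℝ} (hβ : 0 < β) : sinhMoment β 1 = besselK 2 β / β := by
  rw [eq_div_iff hβ.ne', mul_comm, mul_sinhMoment hβ, besselK]
  congr 1
  ext r
  simp [Real.cosh_two_mul]

/-- Substituting `cosh³ = cosh + sinh² cosh` closes the recursion on lower moments; this is the
source of the term `3/β` in `Ψ`. -/
theorem sinhMoment_two {β : ℝ} (hβ : 0 < β) :
    sinhMoment β 2 = (besselK 1 β + 3 * sinhMoment β 1) / β := by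
  have hi (m k : ℕ) := integrableOn_sinh_cosh hβ m k
  rw [eq_div_iff hβ.ne', mul_comm, mul_sinhMoment hβ, besselK, sinhMoment, ← integral_const_mul,
    ← integral_add]
  · congr 1
    ext r
    have := Real.cosh_sq r
    simp only [Nat.cast_one, one_mul]
    push_cast
    rw [show Real.cosh r ^ (2 + 1) = Real.cosh r * (Real.sinh r ^ 2 + 1) by rw [← this]; ring]
    ring
  · simpa [IntegrableOn] using hi 0 1
  · exact (hi 2 1).const_mul 3

/-- By `sinhMoment_one` this is `β` times the integral of a positive function. It makes the
divisions by `M(β)` and by `K₂` legitimate. -/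
theorem besselK_two_pos {β : ℝ} (hβ : 0 < β) : 0 < besselK 2 β := by
  have h : 0 < sinhMoment β 1 := by
    rw [sinhMoment, setIntegral_pos_iff_support_of_nonneg_ae _ (integrableOn_sinh_cosh hβ 2 1)]
    · have : Set.Ioi (0 : ℝ) ⊆ Function.support (fun r : ℝ =>
        Real.sinh r ^ 2 * Real.cosh r ^ 1 * Real.exp (-β * Real.cosh r)) ∩ Set.Ioi 0 := by
        intro r hr
        have hs : 0 < Real.sinh r := Real.sinh_pos_iff.2 hr
        refine ⟨?_, hr⟩
        have : 0 < Real.cosh r := Real.cosh_pos r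
        rw [Function.mem_support]
        positivity
      exact lt_of_lt_of_le (by simp) (measure_mono this)
    · exact Eventually.of_forall fun r => by
        have : 0 < Real.cosh r := Real.cosh_pos r
        simp only [Pi.zero_apply]
        positivity
  rw [sinhMoment_one hβ] at h
  have := mul_pos h hβ
  rwa [div_mul_cancel₀ _ hβ.ne'] at this

/-- The rapidity substitution `|q| = sinh r`, under which `q⁰ = cosh r`. No integrability of `g` is
needed, as `sinh` is an injective change of variables. -/
theorem integral_Ioi_sinh (g : ℝ → ℝ) :
    ∫ y in Set.Ioi (0 : ℝ), g y = ∫ r in Set.Ioi (0 : ℝ), Real.cosh r * g (Real.sinh r) := by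
  have him : Real.sinh '' Set.Ioi 0 = Set.Ioi 0 := by
    ext y
    constructor
    · rintro ⟨r, hr, rfl⟩
      exact Real.sinh_pos_iff.2 hr
    · intro hy
      exact ⟨Real.arsinh y, Real.arsinh_pos_iff.2 hy, Real.sinh_arsinh y⟩
  have h := integral_image_eq_integral_abs_deriv_smul (f := Real.sinh) (f' := Real.cosh)
    (s := Set.Ioi (0 : ℝ)) measurableSet_Ioi
    (fun x _ => (Real.hasDerivAt_sinh x).hasDerivWithinAt) Real.sinh_injective.injOn g
  rw [him] at h
  rw [h]
  congr 1
  ext r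
  rw [abs_of_pos (Real.cosh_pos r), smul_eq_mul]

/-- Integrals over momentum space in rapidity coordinates. -/
theorem integral_energy_eq (g : ℝ → ℝ) :
    ∫ q : E3, g (energy q) = (3 * (volume : Measure E3).real (Metric.ball 0 1)) *
      ∫ r in Set.Ioi (0 : ℝ), Real.sinh r ^ 2 * Real.cosh r * g (Real.cosh r) := by
  have h := integral_fun_norm_addHaar (volume : Measure E3) (fun y => g √(1 + y ^ 2))
  unfold energy
  rw [h, integral_Ioi_sinh]
  simp only [finrank_euclideanSpace, Fintype.card_fin, nsmul_eq_mul, smul_eq_mul]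
  rw [← mul_assoc]
  congr 2
  ext r
  rw [← Real.cosh_sq', Real.sqrt_sq (Real.cosh_pos r).le]
  ring

theorem unitBall_pos : 0 < 3 * (volume : Measure E3).real (Metric.ball 0 1) := by
  have : 0 < (volume : Measure E3).real (Metric.ball 0 1) :=
    ENNReal.toReal_pos (Metric.measure_ball_pos _ _ one_pos).ne' measure_ball_lt_top.ne
  positivity

theorem normM_eq (β : ℝ) :
    normM β = (3 * (volume : Measure E3).real (Metric.ball 0 1)) * sinhMoment β 1 := by
  rw [normM, integral_energy_eq (fun e => Real.exp (-β * e)), sinhMoment]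
  simp

theorem normM_pos {β : ℝ} (hβ : 0 < β) : 0 < normM β := by
  rw [normM_eq, sinhMoment_one hβ]
  exact mul_pos unitBall_pos (div_pos (besselK_two_pos hβ) hβ)

theorem juttner_nonneg {β : ℝ} (hβ : 0 < β) (q : E3) : 0 ≤ juttner β q :=
  div_nonneg (Real.exp_pos _).le (normM_pos hβ).le

theorem integral_juttner {β : ℝ} (hβ : 0 < β) : ∫ q : E3, juttner β q = 1 := by
  unfold juttner
  rw [integral_div, ← normM, div_self (normM_pos hβ).ne']

theorem integral_juttner_div_energy {β : ℝ} (hβ : 0 < β) :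
    ∫ q : E3, juttner β q / energy q = alphaZero β := by
  have h := integral_energy_eq (fun e => Real.exp (-β * e) / normM β / e)
  unfold juttner
  rw [h]
  have h2 : ∫ r in Set.Ioi (0 : ℝ), Real.sinh r ^ 2 * Real.cosh r *
      (Real.exp (-β * Real.cosh r) / normM β / Real.cosh r) = sinhMoment β 0 / normM β := by
    rw [sinhMoment, ← integral_div]
    congr 1
    ext r
    have := (Real.cosh_pos r).ne'
    field_simp
  rw [h2, normM_eq, alphaZero, sinhMoment_zero hβ, sinhMoment_one hβ]
  have h3 := unitBall_pos.ne'
  have h4 := (besselK_two_pos hβ).ne'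
  -- The surface constant cancels against the one in `M(β)`; only its being nonzero matters.
  generalize 3 * (volume : Measure E3).real (Metric.ball 0 1) = c at h3
  field_simp

theorem integral_juttner_mul_energy {β : ℝ} (hβ : 0 < β) :
    ∫ q : E3, juttner β q * energy q = Psi β := by
  have h := integral_energy_eq (fun e => Real.exp (-β * e) / normM β * e)
  unfold juttner
  rw [h]
  have h2 : ∫ r in Set.Ioi (0 : ℝ), Real.sinh r ^ 2 * Real.cosh r *
      (Real.exp (-β * Real.cosh r) / normM β * Real.cosh r) = sinhMoment β 2 / normM β := by
    rw [sinhMoment, ← integral_div]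
    congr 1
    ext r
    ring
  rw [h2, normM_eq, Psi, sinhMoment_two hβ, sinhMoment_one hβ]
  have h3 := unitBall_pos.ne'
  have h4 := (besselK_two_pos hβ).ne'
  generalize 3 * (volume : Measure E3).real (Metric.ball 0 1) = c at h3
  field_simp
  ring

/-- In this form `κ₀` is the Gram determinant of `1` and `1/q⁰` with respect to the measure `q⁰ J⁰
dq`. -/
theorem kappaZero_eq (β : ℝ) : kappaZero β = alphaZero β * Psi β - 1 := by
  rw [kappaZero, Psi, ← alphaZero]
  ring

theorem integrable_weight_sq {β : ℝ} (hβ : 0 < β) (w : E3 → ℝ) (hw : Continuous w) (C : ℝ)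
    (hC : ∀ q, |w q| ≤ C * energy q ^ 2) : Integrable (fun q : E3 => w q * juttner β q) := by
  have h := (memLp_two_iff_integrable_sq (Continuous.aestronglyMeasurable (by fun_prop))).1
    (memLp_energy_mul hβ)
  refine (h.const_mul C).mono' (Continuous.aestronglyMeasurable (by fun_prop))
    (Eventually.of_forall fun q => ?_)
  rw [mul_pow, Real.sq_sqrt (juttner_nonneg hβ q), Real.norm_eq_abs, abs_mul,
    abs_of_nonneg (juttner_nonneg hβ q), ← mul_assoc]
  exact mul_le_mul_of_nonneg_right (hC q) (juttner_nonneg hβ q)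

/-! ### Symmetries of momentum integrals. -/

theorem energy_linearIsometryEquiv (R : E3 ≃ₗᵢ[ℝ] E3) (q : E3) : energy (R q) = energy q := by
  simp [energy]

theorem juttner_linearIsometryEquiv (β : ℝ) (R : E3 ≃ₗᵢ[ℝ] E3) (q : E3) :
    juttner β (R q) = juttner β q := by
  simp [juttner, energy_linearIsometryEquiv]

theorem integral_comp_linearIsometryEquiv (R : E3 ≃ₗᵢ[ℝ] E3) (g : E3 → ℝ) :
    ∫ q, g (R q) = ∫ q, g q :=
  (R.measurePreserving).integral_comp R.toHomeomorph.measurableEmbedding g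

/-- Reflection in one coordinate. -/
noncomputable def coordReflection (i : Fin 3) : E3 ≃ₗᵢ[ℝ] E3 :=
  LinearIsometryEquiv.piLpCongrRight 2
    (fun j => if j = i then LinearIsometryEquiv.neg ℝ else LinearIsometryEquiv.refl ℝ ℝ)

theorem coordReflection_apply (i j : Fin 3) (q : E3) :
    coordReflection i q j = if j = i then -q j else q j := by
  unfold coordReflection
  simp only [LinearIsometryEquiv.piLpCongrRight_apply]
  split_ifs <;> simp

/-- Invariance of the integral under reflections yields `∫ g = -∫ g`. It holds for the Bochner
integral of any function, so the vanishing of off-diagonal Gram entries needs no integrability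
check. -/
theorem integral_eq_zero_of_reflection {g : E3 → ℝ} (i : Fin 3)
    (h : ∀ q, g (coordReflection i q) = -g q) : ∫ q, g q = 0 := by
  have := integral_comp_linearIsometryEquiv (coordReflection i) g
  simp only [h, integral_neg] at this
  linarith

theorem integral_coord_mul (β : ℝ) (i : Fin 3) (w : ℝ → ℝ) :
    ∫ q : E3, q i * w (energy q) * juttner β q = 0 :=
  integral_eq_zero_of_reflection i fun q => by
    rw [energy_linearIsometryEquiv, juttner_linearIsometryEquiv, coordReflection_apply, if_pos rfl]
    ring

theorem integral_coord_mul_coord (β : ℝ) {i j : Fin 3} (hij : i ≠ j) (w : ℝ → ℝ) :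
    ∫ q : E3, q i * q j * w (energy q) * juttner β q = 0 :=
  integral_eq_zero_of_reflection i fun q => by
    rw [energy_linearIsometryEquiv, juttner_linearIsometryEquiv, coordReflection_apply,
      coordReflection_apply, if_pos rfl, if_neg hij.symm]
    ring

/-- Coordinate swaps make the three integrals equal. Since `|q|² = (q⁰)² - 1`, they add up to `∫ (q⁰
- 1/q⁰) J⁰ = Ψ - α₀ = 3/β`. -/
theorem integral_coord_sq {β : ℝ} (hβ : 0 < β) (i : Fin 3) :
    ∫ q : E3, q i * q i / energy q * juttner β q = 1 / β := by
  have hsym : ∀ k : Fin 3, ∫ q : E3, q k * q k / energy q * juttner β q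
      = ∫ q : E3, q i * q i / energy q * juttner β q := by
    intro k
    have h := integral_comp_linearIsometryEquiv
      (LinearIsometryEquiv.piLpCongrLeft 2 ℝ ℝ (Equiv.swap i k))
      (fun q => q i * q i / energy q * juttner β q)
    rw [← h]
    congr 1
    ext q
    rw [energy_linearIsometryEquiv, juttner_linearIsometryEquiv]
    simp [LinearIsometryEquiv.piLpCongrLeft_apply, Equiv.piCongrLeft'_apply]
  have hint : ∀ k : Fin 3, Integrable (fun q : E3 => q k * q k / energy q * juttner β q) := by
    intro k
    refine integrable_weight_sq hβ _ (by
      have hne : ∀ q, energy q ≠ 0 := fun q => (energy_pos q).ne'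
      fun_prop (disch := exact hne _)) 1 fun q => ?_
    have h0 := energy_pos q
    rw [abs_div, abs_mul, abs_of_pos h0, div_le_iff₀ h0, one_mul]
    have h1 := abs_coord_le q k
    calc |q k| * |q k| ≤ energy q * energy q := by gcongr
      _ = energy q ^ 2 * 1 := by ring
      _ ≤ energy q ^ 2 * energy q := by gcongr; exact one_le_energy q
  have hsum : ∑ k : Fin 3, ∫ q : E3, q k * q k / energy q * juttner β q = 3 / β := by
    rw [← integral_finsetSum _ fun k _ => hint k]
    have e1 : ∀ q : E3, ∑ k : Fin 3, q k * q k / energy q * juttner β q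
        = juttner β q * energy q - juttner β q / energy q := by
      intro q
      have h0 := (energy_pos q).ne'
      have hE : energy q ^ 2 = 1 + ∑ k : Fin 3, q k * q k := by
        rw [energy, Real.sq_sqrt (by positivity), EuclideanSpace.norm_sq_eq]
        simp [sq]
      rw [← Finset.sum_mul, ← Finset.sum_div,
        show ∑ k : Fin 3, q k * q k = energy q ^ 2 - 1 by linarith]
      field_simp
    simp only [e1]
    have hi1 : Integrable (fun q : E3 => juttner β q * energy q) := by
      have := integrable_weight_sq hβ energy (by fun_prop) 1 (fun q => by
        rw [abs_of_pos (energy_pos q)]; nlinarith [one_le_energy q])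
      simpa [mul_comm] using this
    have hi2 : Integrable (fun q : E3 => juttner β q / energy q) := by
      have := integrable_weight_sq hβ (fun q => (energy q)⁻¹) (by
        have hne : ∀ q, energy q ≠ 0 := fun q => (energy_pos q).ne'
        fun_prop (disch := exact hne _)) 1 (fun q => by
        have := one_le_energy q
        rw [abs_of_pos (inv_pos.2 (energy_pos q)), one_mul]
        exact (inv_le_one_of_one_le₀ this).trans (one_le_pow₀ this))
      refine this.congr (Eventually.of_forall fun q => ?_)
      simp only
      ring
    rw [integral_sub hi1 hi2, integral_juttner_mul_energy hβ, integral_juttner_div_energy hβ, Psi,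
      alphaZero]
    ring
  rw [Finset.sum_congr rfl fun k _ => hsym k] at hsum
  simp only [Finset.sum_const, Finset.card_univ, Fintype.card_fin, nsmul_eq_mul] at hsum
  push_cast at hsum
  rw [show (3 : ℝ) / β = 3 * (1 / β) by ring] at hsum
  exact mul_left_cancel₀ (by norm_num) hsum

/-! ### Dissipativity of the collision operator -/

/-- Bessel's inequality for a family of five vectors with the Gram matrix of the collision
invariants. -/
theorem re_gram_form_le_norm_sq {V : Type*} [NormedAddCommGroup V] [InnerProductSpace ℂ V]
    {b α Ψ κ : ℝ} (hb : b ≠ 0) (hκ : κ = α * Ψ - 1) (e : Fin 3 → V) (e₀ e₁ u : V)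
    (hee : ∀ i j, inner ℂ (e i) (e j) = if i = j then ((1 / b : ℝ) : ℂ) else 0)
    (he0 : ∀ i, inner ℂ (e i) e₀ = 0) (he1 : ∀ i, inner ℂ (e i) e₁ = 0)
    (h00 : inner ℂ e₀ e₀ = (Ψ : ℂ)) (h01 : inner ℂ e₀ e₁ = 1) (h11 : inner ℂ e₁ e₁ = (α : ℂ)) :
    ((b : ℂ) * ∑ i, inner ℂ u (e i) * inner ℂ (e i) u
      + inner ℂ u e₀ * ((α * inner ℂ e₀ u - inner ℂ e₁ u) / κ)
      + inner ℂ u e₁ * ((Ψ * inner ℂ e₁ u - inner ℂ e₀ u) / κ)).re ≤ ‖u‖ ^ 2 := by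
  have h10 : inner ℂ e₁ e₀ = 1 := by rw [← inner_conj_symm, h01, map_one]
  have h0e : ∀ i, inner ℂ e₀ (e i) = 0 := fun i => by rw [← inner_conj_symm, he0, map_zero]
  have h1e : ∀ i, inner ℂ e₁ (e i) = 0 := fun i => by rw [← inner_conj_symm, he1, map_zero]
  set c : Fin 3 → ℂ := fun i => inner ℂ (e i) u with hc
  set c₀ : ℂ := inner ℂ e₀ u with hc0
  set c₁ : ℂ := inner ℂ e₁ u with hc1
  -- For `κ ≠ 0` this is the orthogonal projection of `u` onto the span of the five vectors, with
  -- coefficients from the inverse Gram matrix; the form to be bounded is `⟨u, p⟩`.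
  set p : V := ∑ i, (b * c i : ℂ) • e i + ((α * c₀ - c₁) / κ : ℂ) • e₀
    + ((Ψ * c₁ - c₀) / κ : ℂ) • e₁ with hp
  have hep : ∀ i, inner ℂ (e i) p = c i := by
    intro i
    have hb' : (b : ℂ) ≠ 0 := by exact_mod_cast hb
    simp only [hp, inner_add_right, inner_sum, inner_smul_right, hee, he0, he1, mul_ite, mul_zero,
      Finset.sum_ite_eq, Finset.mem_univ, if_true, add_zero]
    push_cast
    field_simp
  have h0p : inner ℂ e₀ p = (α * c₀ - c₁) / κ * Ψ + (Ψ * c₁ - c₀) / κ := by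
    simp only [hp, inner_add_right, inner_sum, inner_smul_right, h0e, h00, h01, mul_zero,
      Finset.sum_const_zero, zero_add, mul_one]
  have h1p : inner ℂ e₁ p = (α * c₀ - c₁) / κ + (Ψ * c₁ - c₀) / κ * α := by
    simp only [hp, inner_add_right, inner_sum, inner_smul_right, h1e, h10, h11, mul_zero,
      Finset.sum_const_zero, zero_add, mul_one]
  have hup : ∀ w : V, inner ℂ w p = (b : ℂ) * ∑ i, inner ℂ w (e i) * c i
      + inner ℂ w e₀ * ((α * c₀ - c₁) / κ) + inner ℂ w e₁ * ((Ψ * c₁ - c₀) / κ) := by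
    intro w
    simp only [hp, inner_add_right, inner_sum, inner_smul_right, Finset.mul_sum]
    congr 1
    · congr 1
      · exact Finset.sum_congr rfl fun i _ => by ring
      · ring
    · ring
  have hpu : inner ℂ p u = inner ℂ p p := by
    rw [← inner_conj_symm p u, hup u, hup p, ← inner_conj_symm p e₀, ← inner_conj_symm p e₁, h0p,
      h1p]
    have hpe : ∀ i, inner ℂ p (e i) = (starRingEnd ℂ) (c i) := fun i => by
      rw [← inner_conj_symm, hep]
    have hue : ∀ i, inner ℂ u (e i) = (starRingEnd ℂ) (c i) := fun i => by
      rw [← inner_conj_symm]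
    have hu0 : inner ℂ u e₀ = (starRingEnd ℂ) c₀ := by rw [← inner_conj_symm]
    have hu1 : inner ℂ u e₁ = (starRingEnd ℂ) c₁ := by rw [← inner_conj_symm]
    simp only [hpe, hue, hu0, hu1, map_add, map_mul, map_div₀, map_sub, Complex.conj_ofReal,
      Complex.conj_conj, map_sum]
    have hκ' : (κ : ℂ) = α * Ψ - 1 := by exact_mod_cast hκ
    -- A vanishing determinant need not be excluded: division by zero then removes the `e₀` and `e₁`
    -- terms, and `p` is the projection onto the span of the `e i` alone.
    rcases eq_or_ne (κ : ℂ) 0 with h | h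
    · simp only [h, div_zero, mul_zero, zero_mul, add_zero]
      congr 1
      exact Finset.sum_congr rfl fun i _ => by ring
    · have hsum : ∑ i, c i * (starRingEnd ℂ) (c i) = ∑ i, (starRingEnd ℂ) (c i) * c i :=
        Finset.sum_congr rfl fun i _ => by ring
      rw [hsum, add_assoc, add_assoc]
      congr 1
      field_simp
      rw [hκ']
      ring
  rw [← hup u]
  have h1 : (inner ℂ u p).re = ‖p‖ ^ 2 := by
    have h2 : (inner ℂ u p).re = (inner ℂ p u).re := inner_re_symm (𝕜 := ℂ) u p
    rw [h2, hpu, inner_self_eq_norm_sq_to_K]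
    norm_cast
  have h3 : (inner ℂ u p).re ≤ ‖u‖ * ‖p‖ := re_inner_le_norm (𝕜 := ℂ) u p
  -- From `‖p‖² = Re ⟨u, p⟩ ≤ ‖u‖ ‖p‖ ≤ (‖u‖² + ‖p‖²) / 2`.
  nlinarith [sq_nonneg (‖u‖ - ‖p‖)]

/-! ### Collision invariants, symmetrised by the factor `√q⁰`. -/

/-- The class of `inWeight j · √J⁰` in `L²(ℝ³_q)`. -/
noncomputable def inVec {β : ℝ} (hβ : 0 < β) (j : Fin 3 ⊕ Fin 2) : L2q :=
  (memLp_inWeight hβ j).toLp _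

/-- The class of `outWeight β j · √J⁰` in `L²(ℝ³_q)`. -/
noncomputable def outVec {β : ℝ} (hβ : 0 < β) (j : Fin 3 ⊕ Fin 2) : L2q :=
  (memLp_outWeight hβ j).toLp _

/-- The factor `1/q⁰` in `L` is split evenly: `√q⁰` goes to the invariants and `1/√q⁰` to the
argument `v`. In these variables `P` becomes a self-adjoint form to which Bessel's inequality
applies. -/
theorem memLp_inWeight_sqrt {β : ℝ} (hβ : 0 < β) (j : Fin 3 ⊕ Fin 2) :
    MemLp (fun q : E3 => ((inWeight j q * √(energy q) * √(juttner β q) : ℝ) : ℂ)) 2 volume := by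
  have hne : ∀ q, energy q ≠ 0 := fun q => (energy_pos q).ne'
  have hcont : Continuous fun q : E3 => inWeight j q * √(energy q) := by
    rcases j with i | j
    · unfold inWeight
      fun_prop (disch := exact hne _)
    · fin_cases j
      · change Continuous fun q : E3 => 1 * √(energy q)
        fun_prop
      · change Continuous fun q : E3 => 1 / energy q * √(energy q)
        fun_prop (disch := exact hne _)
  refine memLp_weight hβ _ hcont 1 fun q => ?_
  have h0 := energy_pos q
  have h1 : |inWeight j q| ≤ 1 := by
    rcases j with i | j
    · rw [inWeight, abs_div, abs_of_pos h0, div_le_iff₀ h0, one_mul]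
      exact abs_coord_le q i
    · fin_cases j
      · simp [inWeight]
      · simp only [inWeight]
        rw [abs_div, abs_one, abs_of_pos h0, div_le_iff₀ h0, one_mul]
        exact one_le_energy q
  have h2 : √(energy q) ≤ energy q := Real.sqrt_le_self_iff.2 (Or.inr (one_le_energy q))
  rw [abs_mul, abs_of_nonneg (Real.sqrt_nonneg _)]
  exact mul_le_mul h1 h2 (Real.sqrt_nonneg _) zero_le_one

theorem memLp_div_sqrt_energy (v : L2q) :
    MemLp (fun q : E3 => ((√(energy q))⁻¹ : ℂ) * v q) 2 volume := by
  have hne : ∀ q, (√(energy q) : ℂ) ≠ 0 := fun q => by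
    exact_mod_cast (Real.sqrt_pos.2 (energy_pos q)).ne'
  have hc : Continuous fun q : E3 => ((√(energy q) : ℂ))⁻¹ := by
    fun_prop (disch := exact hne _)
  refine (Lp.memLp v).of_le (hc.aestronglyMeasurable.mul (Lp.memLp v).1)
    (Eventually.of_forall fun q => ?_)
  rw [norm_mul, norm_inv, Complex.norm_real, Real.norm_of_nonneg (Real.sqrt_nonneg _)]
  have h1 : 1 ≤ √(energy q) := Real.one_le_sqrt.2 (one_le_energy q)
  exact mul_le_of_le_one_left (norm_nonneg _) (inv_le_one_of_one_le₀ h1)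

/-- Inner products of the weighted collision invariants. -/
theorem inner_inWeight_sqrt {β : ℝ} (hβ : 0 < β) (j k : Fin 3 ⊕ Fin 2) :
    (inner ℂ ((memLp_inWeight_sqrt hβ j).toLp _ : L2q)
      ((memLp_inWeight_sqrt hβ k).toLp _ : L2q) : ℂ)
      = ((∫ q, inWeight j q * inWeight k q * energy q * juttner β q : ℝ) : ℂ) := by
  rw [L2.inner_def, ← integral_complex_ofReal]
  apply integral_congr_ae
  filter_upwards [(memLp_inWeight_sqrt hβ j).coeFn_toLp, (memLp_inWeight_sqrt hβ k).coeFn_toLp]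
    with q h1 h2
  rw [h1, h2, RCLike.inner_apply, Complex.conj_ofReal, ← Complex.ofReal_mul]
  congr 1
  have h3 := Real.mul_self_sqrt (energy_pos q).le
  have h4 := Real.mul_self_sqrt (juttner_nonneg hβ q)
  linear_combination (inWeight j q * inWeight k q * √(juttner β q) * √(juttner β q)) * h3
    + (inWeight j q * inWeight k q * energy q) * h4

theorem inner_inWeight_sqrt_div {β : ℝ} (hβ : 0 < β) (j : Fin 3 ⊕ Fin 2) (v : L2q) :
    (inner ℂ ((memLp_inWeight_sqrt hβ j).toLp _ : L2q)
      ((memLp_div_sqrt_energy v).toLp _ : L2q) : ℂ)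
      = inner ℂ (inVec hβ j) v := by
  rw [inVec, L2.inner_def, L2.inner_def]
  apply integral_congr_ae
  filter_upwards [(memLp_inWeight_sqrt hβ j).coeFn_toLp, (memLp_div_sqrt_energy v).coeFn_toLp,
    (memLp_inWeight hβ j).coeFn_toLp] with q h1 h2 h3
  rw [h1, h2, h3, RCLike.inner_apply, RCLike.inner_apply, Complex.conj_ofReal, Complex.conj_ofReal]
  have hne : (√(energy q) : ℂ) ≠ 0 := by
    exact_mod_cast (Real.sqrt_pos.2 (energy_pos q)).ne'
  push_cast
  field_simp

theorem outWeight_toLp_inl {β : ℝ} (hβ : 0 < β) (i : Fin 3) :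
    (outVec hβ (.inl i))
      = (β : ℂ) • (inVec hβ (.inl i)) := by
  unfold inVec outVec
  rw [← MemLp.toLp_const_smul]
  apply MemLp.toLp_congr
  refine Eventually.of_forall fun q => ?_
  simp only [Pi.smul_apply, smul_eq_mul, outWeight, inWeight]
  push_cast
  ring

/-- The coefficients form a row of `(Ψ 1; 1 α₀)⁻¹ = κ₀⁻¹ (α₀ -1; -1 Ψ)`; `outWeight_toLp_inr_one`
provides the other one. This is how the formula for `P` encodes a projection. -/
theorem outWeight_toLp_inr_zero {β : ℝ} (hβ : 0 < β) :
    (outVec hβ (.inr 0))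
      = ((alphaZero β / kappaZero β : ℝ) : ℂ) • (inVec hβ (.inr 0))
        - ((1 / kappaZero β : ℝ) : ℂ) • (inVec hβ (.inr 1)) := by
  unfold inVec outVec
  rw [← MemLp.toLp_const_smul, ← MemLp.toLp_const_smul, ← MemLp.toLp_sub]
  apply MemLp.toLp_congr
  refine Eventually.of_forall fun q => ?_
  simp only [Pi.smul_apply, Pi.sub_apply, smul_eq_mul, outWeight, inWeight]
  have := (energy_pos q).ne'
  rw [← Complex.ofReal_mul, ← Complex.ofReal_mul, ← Complex.ofReal_sub]
  congr 1
  field_simp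

theorem outWeight_toLp_inr_one {β : ℝ} (hβ : 0 < β) :
    (outVec hβ (.inr 1))
      = ((Psi β / kappaZero β : ℝ) : ℂ) • (inVec hβ (.inr 1))
        - ((1 / kappaZero β : ℝ) : ℂ) • (inVec hβ (.inr 0)) := by
  unfold inVec outVec
  rw [← MemLp.toLp_const_smul, ← MemLp.toLp_const_smul, ← MemLp.toLp_sub]
  apply MemLp.toLp_congr
  refine Eventually.of_forall fun q => ?_
  simp only [Pi.smul_apply, Pi.sub_apply, smul_eq_mul, outWeight, inWeight]
  have := (energy_pos q).ne'
  rw [← Complex.ofReal_mul, ← Complex.ofReal_mul, ← Complex.ofReal_sub]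
  congr 1
  field_simp

/-- The transport symbol `i ζ·q / q⁰` is purely imaginary, so only the damping `1/q⁰` contributes to
the real part. -/
theorem re_inner_multiplier (ζ : E3) (v : L2q) :
    (inner ℂ v ((ContinuousLinearMap.mul ℂ ℂ).holder 2 ((memLp_multiplier ζ).toLp _) v)).re
      = ‖((memLp_div_sqrt_energy v).toLp _ : L2q)‖ ^ 2 := by
  set w : L2q := (ContinuousLinearMap.mul ℂ ℂ).holder 2 ((memLp_multiplier ζ).toLp _) v with hw
  have h1 : (inner ℂ v w).re = ∫ q, (inner ℂ (v q) (w q)).re := by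
    rw [L2.inner_def]
    exact (integral_re (𝕜 := ℂ) (L2.integrable_inner v w)).symm
  have h2 : ‖((memLp_div_sqrt_energy v).toLp _ : L2q)‖ ^ 2
      = ∫ q, ‖((√(energy q))⁻¹ : ℂ) * v q‖ ^ 2 := by
    have h3 := inner_self_eq_norm_sq (𝕜 := ℂ) ((memLp_div_sqrt_energy v).toLp _ : L2q)
    rw [← h3, L2.inner_def]
    rw [← integral_re (L2.integrable_inner _ _)]
    apply integral_congr_ae
    filter_upwards [(memLp_div_sqrt_energy v).coeFn_toLp] with q hq
    rw [inner_self_eq_norm_sq, hq]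
  rw [h1, h2]
  apply integral_congr_ae
  filter_upwards [(ContinuousLinearMap.mul ℂ ℂ).coeFn_holder (r := 2)
    ((memLp_multiplier ζ).toLp _) v, (memLp_multiplier ζ).coeFn_toLp] with q h6 h7
  rw [hw, h6, h7, ContinuousLinearMap.mul_apply', norm_mul, norm_inv, Complex.norm_real,
    Real.norm_of_nonneg (Real.sqrt_nonneg _), mul_pow, inv_pow, Real.sq_sqrt (energy_pos q).le,
    RCLike.inner_apply, multiplier, mul_assoc, Complex.mul_conj, Complex.normSq_eq_norm_sq,
    Complex.re_mul_ofReal, Complex.div_ofReal_re]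
  simp

/-- The fibre generators are dissipative. -/
theorem re_inner_fiberGenerator_nonpos {β : ℝ} (hβ : 0 < β) (ζ : E3) (v : L2q) :
    (inner ℂ v (fiberGenerator β hβ ζ v)).re ≤ 0 := by
  have hne : ∀ q, energy q ≠ 0 := fun q => (energy_pos q).ne'
  have hgram := re_gram_form_le_norm_sq hβ.ne' (kappaZero_eq β)
    (fun i => ((memLp_inWeight_sqrt hβ (.inl i)).toLp _ : L2q))
    ((memLp_inWeight_sqrt hβ (.inr 0)).toLp _ : L2q)
    ((memLp_inWeight_sqrt hβ (.inr 1)).toLp _ : L2q)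
    ((memLp_div_sqrt_energy v).toLp _ : L2q)
    (fun i j => by
      rw [inner_inWeight_sqrt hβ]
      have h : ∀ q : E3, inWeight (.inl i) q * inWeight (.inl j) q * energy q * juttner β q
          = q i * q j * (fun E => 1 / E) (energy q) * juttner β q := by
        intro q
        have := hne q
        simp only [inWeight]
        field_simp
      simp only [h]
      split_ifs with hij
      · subst hij
        rw [← integral_coord_sq hβ i]
        congr 2
        ext q
        ring
      · rw [integral_coord_mul_coord β hij (fun E => 1 / E)]
        simp)
    (fun i => by
      rw [inner_inWeight_sqrt hβ]
      have h : ∀ q : E3, inWeight (.inl i) q * inWeight (.inr 0) q * energy q * juttner β q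
          = q i * (fun _ => 1) (energy q) * juttner β q := by
        intro q
        have := hne q
        simp only [inWeight]
        field_simp
      simp only [h]
      rw [integral_coord_mul β i (fun _ => 1)]
      simp)
    (fun i => by
      rw [inner_inWeight_sqrt hβ]
      have h : ∀ q : E3, inWeight (.inl i) q * inWeight (.inr 1) q * energy q * juttner β q
          = q i * (fun E => 1 / E) (energy q) * juttner β q := by
        intro q
        have := hne q
        simp only [inWeight]
        field_simp
      simp only [h]
      rw [integral_coord_mul β i (fun E => 1 / E)]
      simp)
    (by
      rw [inner_inWeight_sqrt hβ, ← integral_juttner_mul_energy hβ]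
      congr 2
      ext q
      simp only [inWeight]
      ring)
    (by
      rw [inner_inWeight_sqrt hβ, ← Complex.ofReal_one, ← integral_juttner hβ]
      congr 2
      ext q
      have := hne q
      simp only [inWeight]
      field_simp)
    (by
      rw [inner_inWeight_sqrt hβ, ← integral_juttner_div_energy hβ]
      congr 2
      ext q
      have := hne q
      simp only [inWeight]
      field_simp)
  -- The norm of `v / √q⁰` in Bessel's inequality is exactly the dissipation of the multiplication
  -- part, so the inequality compares gain and loss in `B̂(ζ)`.
  rw [← re_inner_multiplier ζ v] at hgram
  have hin := fun j => inner_inWeight_sqrt_div hβ j v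
  have hin' : ∀ j, (inner ℂ ((memLp_div_sqrt_energy v).toLp _ : L2q)
      ((memLp_inWeight_sqrt hβ j).toLp _ : L2q) : ℂ)
      = inner ℂ v (inVec hβ j) := fun j => by
    rw [← inner_conj_symm, hin, inner_conj_symm]
  simp only [hin, hin'] at hgram
  have hexp : fiberGenerator β hβ ζ v
      = ∑ j : Fin 3 ⊕ Fin 2, (inner ℂ (inVec hβ j) v : ℂ) •
          (outVec hβ j)
        - (ContinuousLinearMap.mul ℂ ℂ).holder 2 ((memLp_multiplier ζ).toLp _) v := by
    simp only [fiberGenerator, sub_apply, sum_apply,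
      ContinuousLinearMap.smulRight_apply, innerSL_apply_apply]
    rfl
  rw [hexp, inner_sub_right, Complex.sub_re, sub_nonpos]
  refine le_trans (le_of_eq ?_) hgram
  congr 1
  simp only [inner_add_right, inner_sum, inner_smul_right, Fintype.sum_sum_type, Fin.sum_univ_two,
    outWeight_toLp_inl, outWeight_toLp_inr_zero, outWeight_toLp_inr_one, inner_sub_right]
  rw [add_assoc, Finset.mul_sum]
  congr 1
  · exact Finset.sum_congr rfl fun i _ => by ring
  · push_cast
    ring

/-! ### Contraction semigroups of the fibre generators -/

section Contraction

variable {V : Type*} [NormedAddCommGroup V] [InnerProductSpace ℂ V] [CompleteSpace V]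

theorem hasDerivAt_exp_smul_apply (A : V →L[ℂ] V) (v : V) (t : ℝ) :
    HasDerivAt (fun s : ℝ => NormedSpace.exp ((s : ℂ) • A) v)
      (A (NormedSpace.exp ((t : ℂ) • A) v)) t := by
  have h := (hasDerivAt_exp_smul_const' (𝕂 := ℂ) A (t : ℂ)).clm_apply (hasDerivAt_const (t : ℂ) v)
  have h2 := h.scomp t Complex.ofRealCLM.hasDerivAt
  simpa [Function.comp_def] using h2

/-- The semigroup of a bounded dissipative operator is contractive. -/
theorem norm_exp_smul_apply_le {A : V →L[ℂ] V} (hA : ∀ v, (inner ℂ v (A v)).re ≤ 0) (v : V)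
    {t : ℝ} (ht : 0 ≤ t) : ‖NormedSpace.exp ((t : ℂ) • A) v‖ ≤ ‖v‖ := by
  set u : ℝ → V := fun s => NormedSpace.exp ((s : ℂ) • A) v with hu
  have hd : ∀ s, HasDerivAt u (A (u s)) s := hasDerivAt_exp_smul_apply A v
  have hd2 : ∀ s, HasDerivAt (fun s => (inner ℂ (u s) (u s)).re)
      (2 * (inner ℂ (u s) (A (u s))).re) s := by
    intro s
    have h := (hd s).inner ℂ (hd s)
    have h2 := Complex.reCLM.hasFDerivAt.comp_hasDerivAt s h
    convert! h2 using 1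
    have h3 : (inner ℂ (u s) (A (u s))).re = (inner ℂ (A (u s)) (u s)).re :=
      inner_re_symm (𝕜 := ℂ) _ _
    simp only [Complex.reCLM_apply, Complex.add_re]
    rw [← h3]
    ring
  have hanti : Antitone fun s => (inner ℂ (u s) (u s)).re := by
    apply antitone_of_deriv_nonpos (fun s => (hd2 s).differentiableAt)
    intro s
    rw [(hd2 s).deriv]
    linarith [hA (u s)]
  have h4 := hanti ht
  have h5 : ∀ w : V, (inner ℂ w w).re = ‖w‖ ^ 2 := fun w => inner_self_eq_norm_sq (𝕜 := ℂ) w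
  simp only [h5] at h4
  have h6 : u 0 = v := by simp [hu]
  rw [h6] at h4
  exact (sq_le_sq₀ (norm_nonneg _) (norm_nonneg _)).1 h4

end Contraction

/-! ### Velocity multipliers and dependence of the generators on the frequency. -/

theorem continuous_velocity : Continuous velocity := by
  unfold velocity
  have hne : ∀ q, energy q ≠ 0 := fun q => (energy_pos q).ne'
  fun_prop (disch := exact hne _)

theorem norm_velocity_le (q : E3) : ‖velocity q‖ ≤ 1 := by
  rw [velocity, norm_smul, norm_inv, Real.norm_of_nonneg (energy_pos q).le,
    inv_mul_le_iff₀ (energy_pos q), mul_one]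
  exact norm_le_energy q

theorem memLp_velocity (i : Fin 3) :
    MemLp (fun q : E3 => ((velocity q i : ℝ) : ℂ)) ⊤ (volume : Measure E3) := by
  have hc : Continuous fun q : E3 => ((velocity q i : ℝ) : ℂ) :=
    Complex.continuous_ofReal.comp ((EuclideanSpace.proj i).continuous.comp continuous_velocity)
  refine memLp_top_of_bound hc.aestronglyMeasurable 1 (Eventually.of_forall fun q => ?_)
  rw [Complex.norm_real]
  exact (PiLp.norm_apply_le _ i).trans (norm_velocity_le q)

/-- Multiplication by the component `q̂ᵢ` of the velocity. -/
noncomputable def velMul (i : Fin 3) : L2q →L[ℂ] L2q :=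
  (ContinuousLinearMap.mul ℂ ℂ).holderL (volume : Measure E3) ⊤ 2 2 ((memLp_velocity i).toLp _)

theorem velMul_coeFn (i : Fin 3) (f : L2q) :
    (velMul i f : E3 → ℂ) =ᵐ[volume] fun q => ((velocity q i : ℝ) : ℂ) * f q := by
  have h : velMul i f
      = (ContinuousLinearMap.mul ℂ ℂ).holder 2 ((memLp_velocity i).toLp _) f := rfl
  rw [h]
  filter_upwards [(ContinuousLinearMap.mul ℂ ℂ).coeFn_holder (r := 2)
    ((memLp_velocity i).toLp _) f, (memLp_velocity i).coeFn_toLp] with q h6 h7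
  rw [h6, h7, ContinuousLinearMap.mul_apply']

/-- Being affine in `ζ` with bounded coefficients, `B̂` is norm continuous, which gives
measurability of the propagators. The splitting also allows each factor `ζᵢ` to be traded for an
`x`-derivative of a test function. -/
theorem fiberGenerator_eq (β : ℝ) (hβ : 0 < β) (ζ : E3) :
    fiberGenerator β hβ ζ
      = fiberGenerator β hβ 0 - ∑ i, (Complex.I * (ζ i : ℂ)) • velMul i := by
  ext1 f
  rw [sub_apply, sum_apply, Fin.sum_univ_three]
  simp only [smul_apply]
  apply Lp.ext
  have s (i) := Lp.coeFn_smul (Complex.I * (ζ i : ℂ)) (velMul i f)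
  filter_upwards [fiberGenerator_coeFn β hβ ζ f, fiberGenerator_coeFn β hβ 0 f,
    Lp.coeFn_sub (fiberGenerator β hβ 0 f) ((Complex.I * (ζ 0 : ℂ)) • velMul 0 f
      + (Complex.I * (ζ 1 : ℂ)) • velMul 1 f + (Complex.I * (ζ 2 : ℂ)) • velMul 2 f),
    Lp.coeFn_add ((Complex.I * (ζ 0 : ℂ)) • velMul 0 f
      + (Complex.I * (ζ 1 : ℂ)) • velMul 1 f) ((Complex.I * (ζ 2 : ℂ)) • velMul 2 f),
    Lp.coeFn_add ((Complex.I * (ζ 0 : ℂ)) • velMul 0 f) ((Complex.I * (ζ 1 : ℂ)) • velMul 1 f),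
    s 0, s 1, s 2, velMul_coeFn 0 f, velMul_coeFn 1 f, velMul_coeFn 2 f]
    with q h1 h2 h3 h4 h5 s0 s1 s2 v0 v1 v2
  rw [h3, Pi.sub_apply, h4, Pi.add_apply, h5, Pi.add_apply, s0, s1, s2, h1, h2]
  simp only [Pi.smul_apply, v0, v1, v2, smul_eq_mul, inner_zero_left]
  rw [PiLp.inner_apply, Fin.sum_univ_three]
  simp only [RCLike.inner_apply, conj_trivial]
  push_cast
  ring

theorem continuous_fiberGenerator (β : ℝ) (hβ : 0 < β) : Continuous (fiberGenerator β hβ) := by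
  have h : fiberGenerator β hβ = fun ζ => fiberGenerator β hβ 0
      - ∑ i, (Complex.I * (ζ i : ℂ)) • velMul i := funext (fiberGenerator_eq β hβ)
  rw [h]
  fun_prop

theorem continuous_exp_fiberGenerator (β : ℝ) (hβ : 0 < β) (t : ℝ) (c : ℝ) :
    Continuous fun ξ : E3 => NormedSpace.exp ((t : ℂ) • fiberGenerator β hβ (c • ξ)) := by
  have h := continuous_fiberGenerator β hβ
  have h2 : Continuous fun ξ : E3 => (t : ℂ) • fiberGenerator β hβ (c • ξ) := by fun_prop
  exact (continuous_iff_continuousAt.2 fun A : L2q →L[ℂ] L2q =>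
    (NormedSpace.exp_analytic (𝕂 := ℂ) A).continuousAt).comp h2

theorem norm_exp_fiberGenerator_apply_le {β : ℝ} (hβ : 0 < β) (ζ : E3) (v : L2q) {t : ℝ}
    (ht : 0 ≤ t) : ‖NormedSpace.exp ((t : ℂ) • fiberGenerator β hβ ζ) v‖ ≤ ‖v‖ :=
  norm_exp_smul_apply_le (re_inner_fiberGenerator_nonpos hβ ζ) v ht

/-! ### The Fourier transform of `L²(ℝ³; L²(ℝ³))` and Schwartz functions -/

theorem integrable_schwartz_smul (θ : 𝓢(E3, ℂ)) (f : L2xq) :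
    Integrable (fun x => θ x • f x) := by
  have h : MemLp (fun x => θ x • f x) 1 volume := MemLp.smul (Lp.memLp f) (θ.memLp 2 volume)
  exact memLp_one_iff_integrable.1 h

/-- Duality with Schwartz functions is how the Fourier transform of an `L²` function is accessed
below; with `Lp_eq_of_integral_schwartz` it characterises that transform. -/
theorem integral_smul_fourier (θ : 𝓢(E3, ℂ)) (f : L2xq) :
    ∫ ξ, θ ξ • (𝓕 f : L2xq) ξ = ∫ x, (𝓕 θ) x • f x := by
  have h := congrArg (fun T => T θ) (Lp.fourier_toTemperedDistribution_eq f)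
  simp only [TemperedDistribution.fourier_apply, Lp.toTemperedDistribution_apply] at h
  exact h.symm

theorem Lp_eq_of_integral_schwartz {f g : L2xq}
    (h : ∀ θ : 𝓢(E3, ℂ), ∫ x, θ x • f x = ∫ x, θ x • g x) : f = g := by
  have h2 := Lp.ker_toTemperedDistributionCLM_eq_bot (E := E3) (F := L2q) (μ := volume) (p := 2)
  apply LinearMap.ker_eq_bot.1 h2
  ext1 θ
  simp only [ContinuousLinearMap.coe_coe, Lp.toTemperedDistributionCLM_apply,
    Lp.toTemperedDistribution_apply]
  exact h θ

/-- The Fourier transform commutes with operators acting on the values. -/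
theorem fourier_compLpL (T : L2q →L[ℂ] L2q) (f : L2xq) :
    (𝓕 (T.compLpL 2 volume f) : L2xq) = T.compLpL 2 volume (𝓕 f : L2xq) := by
  apply Lp_eq_of_integral_schwartz
  intro θ
  have h : ∀ (ψ : 𝓢(E3, ℂ)) (g : L2xq),
      ∫ x, ψ x • (T.compLpL 2 volume g) x = T (∫ x, ψ x • g x) := by
    intro ψ g
    rw [← T.integral_comp_comm (integrable_schwartz_smul ψ g)]
    apply integral_congr_ae
    filter_upwards [T.coeFn_compLpL g] with x hx
    rw [hx, map_smul]
  rw [integral_smul_fourier, h, h, integral_smul_fourier]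

/-! ### Test functions as `L²`-valued maps -/

theorem memLp_slice {φ : E3 × E3 → ℂ} (hφ : Continuous φ) (hc : HasCompactSupport φ) (x : E3) :
    MemLp (fun q => φ (x, q)) 2 (volume : Measure E3) := by
  apply Continuous.memLp_of_hasCompactSupport (by fun_prop)
  refine HasCompactSupport.of_support_subset_isCompact (hc.image continuous_snd) ?_
  intro q hq
  exact ⟨(x, q), subset_tsupport _ hq, rfl⟩

/-- The map `x ↦ φ(x, ·)` with values in `L²(ℝ³_q)`. -/
noncomputable def slice (φ : E3 × E3 → ℂ) (hφ : Continuous φ) (hc : HasCompactSupport φ) (x : E3) :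
    L2q := (memLp_slice hφ hc x).toLp _

theorem slice_coeFn {φ : E3 × E3 → ℂ} (hφ : Continuous φ) (hc : HasCompactSupport φ) (x : E3) :
    (slice φ hφ hc x : E3 → ℂ) =ᵐ[volume] fun q => φ (x, q) :=
  (memLp_slice hφ hc x).coeFn_toLp

/-- All slices live on one compact set, the projection of the support of `φ`. Uniform continuity of
`φ` therefore controls the `L²` distance, up to the `L²` norm of the indicator of that set. -/
theorem continuous_slice {φ : E3 × E3 → ℂ} (hφ : Continuous φ) (hc : HasCompactSupport φ) :
    Continuous (slice φ hφ hc) := by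
  have hK : IsCompact (Prod.snd '' tsupport φ) := hc.image continuous_snd
  set g : L2q := indicatorConstLp 2 hK.measurableSet hK.measure_lt_top.ne (1 : ℂ) with hg
  rw [Metric.continuous_iff]
  intro x ε hε
  obtain ⟨δ, hδ, hu⟩ := Metric.uniformContinuous_iff.1 (hc.uniformContinuous_of_continuous hφ)
    (ε / (‖g‖ + 1)) (by positivity)
  refine ⟨δ, hδ, fun y hy => ?_⟩
  rw [dist_eq_norm]
  have hle : ‖slice φ hφ hc y - slice φ hφ hc x‖ ≤ ε / (‖g‖ + 1) * ‖g‖ := by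
    apply Lp.norm_le_mul_norm_of_ae_le_mul
    filter_upwards [Lp.coeFn_sub (slice φ hφ hc y) (slice φ hφ hc x), slice_coeFn hφ hc y,
      slice_coeFn hφ hc x, (indicatorConstLp_coeFn (p := 2) (hs := hK.measurableSet)
        (hμs := hK.measure_lt_top.ne) (c := (1 : ℂ)))] with q h1 h2 h3 h4
    rw [h1, Pi.sub_apply, h2, h3, hg, h4]
    by_cases hq : q ∈ Prod.snd '' tsupport φ
    · rw [Set.indicator_of_mem hq, norm_one, mul_one, ← dist_eq_norm]
      refine (hu ?_).le
      rw [Prod.dist_eq, dist_self, max_eq_left dist_nonneg]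
      exact hy
    · have hz : ∀ z, φ (z, q) = 0 := by
        intro z
        by_contra hne
        exact hq ⟨(z, q), subset_tsupport _ hne, rfl⟩
      rw [hz, hz, Set.indicator_of_notMem hq]
      simp
  refine hle.trans_lt ?_
  rw [div_mul_eq_mul_div, div_lt_iff₀ (by positivity)]
  nlinarith [norm_nonneg g]

theorem slice_eq_zero {φ : E3 × E3 → ℂ} (hφ : Continuous φ) (hc : HasCompactSupport φ) {x : E3}
    (hx : ∀ q, φ (x, q) = 0) : slice φ hφ hc x = 0 := by
  apply Lp.ext
  filter_upwards [slice_coeFn hφ hc x, Lp.coeFn_zero ℂ 2 (volume : Measure E3)] with q h1 h2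
  rw [h1, h2, hx, Pi.zero_apply]

theorem hasCompactSupport_slice {φ : E3 × E3 → ℂ} (hφ : Continuous φ) (hc : HasCompactSupport φ) :
    HasCompactSupport (slice φ hφ hc) := by
  refine HasCompactSupport.of_support_subset_isCompact (hc.image continuous_fst) ?_
  intro x hx
  by_contra hne
  refine hx (slice_eq_zero hφ hc fun q => ?_)
  by_contra hq
  exact hne ⟨(x, q), subset_tsupport _ hq, rfl⟩

theorem memLp_testLp {φ : E3 × E3 → ℂ} (hφ : Continuous φ) (hc : HasCompactSupport φ) :
    MemLp (slice φ hφ hc) 2 volume :=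
  (continuous_slice hφ hc).memLp_of_hasCompactSupport (hasCompactSupport_slice hφ hc)

/-- A test function as an element of `L²(ℝ³_x × ℝ³_q)`. -/
noncomputable def testLp (φ : E3 × E3 → ℂ) (hφ : Continuous φ) (hc : HasCompactSupport φ) : L2xq :=
  (memLp_testLp hφ hc).toLp _

theorem testLp_coeFn {φ : E3 × E3 → ℂ} (hφ : Continuous φ) (hc : HasCompactSupport φ) :
    (testLp φ hφ hc : E3 → L2q) =ᵐ[volume] slice φ hφ hc :=
  (memLp_testLp hφ hc).coeFn_toLp

/-- The directional derivative in the position variable. -/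
noncomputable def posDeriv (v : E3) (φ : E3 × E3 → ℂ) (z : E3 × E3) : ℂ := fderiv ℝ φ z (v, 0)

theorem continuous_posDeriv {φ : E3 × E3 → ℂ} (hφ : ContDiff ℝ 1 φ) (v : E3) :
    Continuous (posDeriv v φ) :=
  (hφ.continuous_fderiv one_ne_zero).clm_apply continuous_const

theorem hasCompactSupport_posDeriv {φ : E3 × E3 → ℂ} (hc : HasCompactSupport φ) (v : E3) :
    HasCompactSupport (posDeriv v φ) :=
  hc.fderiv_apply ℝ (v, 0)

theorem fderiv_slice_apply {φ : E3 × E3 → ℂ} (hφ : ContDiff ℝ 1 φ) (v x q : E3) :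
    fderiv ℝ (fun x => φ (x, q)) x v = posDeriv v φ (x, q) := by
  have h1 : HasFDerivAt (fun x : E3 => (x, q)) (ContinuousLinearMap.inl ℝ E3 E3) x :=
    hasFDerivAt_prodMk_left x q
  have h2 := ((hφ.differentiable one_ne_zero) (x, q)).hasFDerivAt.comp x h1
  have h3 : fderiv ℝ (fun x => φ (x, q)) x
      = (fderiv ℝ φ (x, q)).comp (ContinuousLinearMap.inl ℝ E3 E3) := h2.fderiv
  rw [h3]
  rfl

theorem L2q_eq_of_integral_smul {u v : L2q} (h : ∀ g : E3 → ℝ, ContDiff ℝ ∞ g →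
    HasCompactSupport g → ∫ q, (g q : ℂ) * u q = ∫ q, (g q : ℂ) * v q) : u = v := by
  apply Lp.ext
  refine ae_eq_of_integral_contDiff_smul_eq ((Lp.memLp u).locallyIntegrable (by norm_num))
    ((Lp.memLp v).locallyIntegrable (by norm_num)) fun g hg hc => ?_
  simpa only [Complex.real_smul] using h g hg hc

/-- Pairing with `g(q)` is a bounded functional, so it passes under the `L²`-valued integral, and
Fubini exchanges the variables. Identities for such integrals reduce to scalar identities at each
fixed `q`. -/
theorem integral_integral_mul_slice {φ : E3 × E3 → ℂ} (hφ : Continuous φ)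
    (hc : HasCompactSupport φ) (θ : 𝓢(E3, ℂ)) {g : E3 → ℝ} (hg : Continuous g)
    (hgc : HasCompactSupport g) :
    ∫ q, (g q : ℂ) * (∫ x, θ x • slice φ hφ hc x) q = ∫ q, (g q : ℂ) * ∫ x, θ x * φ (x, q) := by
  have hgm : MemLp (fun q => (g q : ℂ)) 2 (volume : Measure E3) :=
    Continuous.memLp_of_hasCompactSupport (by fun_prop) (hgc.comp_left (g := Complex.ofReal) rfl)
  obtain ⟨η, hpair⟩ : ∃ η : L2q →L[ℂ] ℂ, ∀ u : L2q, ∫ q, (g q : ℂ) * u q = η u := by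
    refine ⟨innerSL ℂ (hgm.toLp _ : L2q), fun u => ?_⟩
    rw [innerSL_apply_apply, L2.inner_def]
    apply integral_congr_ae
    filter_upwards [hgm.coeFn_toLp] with q hq
    rw [hq, RCLike.inner_apply, Complex.conj_ofReal, mul_comm]
  have hint : Integrable (fun x => θ x • slice φ hφ hc x) := by
    apply Continuous.integrable_of_hasCompactSupport
    · exact θ.continuous.smul (continuous_slice hφ hc)
    · exact HasCompactSupport.smul_left (f := fun x => θ x) (hasCompactSupport_slice hφ hc)
  rw [hpair, ← η.integral_comp_comm hint]
  have h1 : ∀ x, η (θ x • slice φ hφ hc x)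
      = ∫ q, (g q : ℂ) * (θ x * φ (x, q)) := by
    intro x
    rw [map_smul, ← hpair, smul_eq_mul, ← integral_const_mul]
    apply integral_congr_ae
    filter_upwards [slice_coeFn hφ hc x] with q hq
    rw [hq]
    ring
  simp only [h1]
  rw [integral_integral_swap_of_hasCompactSupport (f := fun x q => (g q : ℂ) * (θ x * φ (x, q)))]
  · congr 1
    ext q
    rw [integral_const_mul]
  · have := θ.continuous
    change Continuous fun z : E3 × E3 => (g z.2 : ℂ) * (θ z.1 * φ (z.1, z.2))
    fun_prop
  · refine HasCompactSupport.of_support_subset_isCompact hc ?_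
    intro z hz
    apply subset_tsupport
    intro h0
    apply hz
    simp [Function.uncurry, h0]

/-- Integration by parts in the position variable, with values in `L²(ℝ³_q)`. -/
theorem integral_smul_slice_posDeriv {φ : E3 × E3 → ℂ} (hφ : ContDiff ℝ 1 φ)
    (hc : HasCompactSupport φ) (v : E3) (θ : 𝓢(E3, ℂ)) :
    ∫ x, θ x • slice (posDeriv v φ) (continuous_posDeriv hφ v) (hasCompactSupport_posDeriv hc v) x
      = -∫ x, (∂_{v} θ) x • slice φ hφ.continuous hc x := by
  apply L2q_eq_of_integral_smul
  intro g hg hgc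
  rw [integral_integral_mul_slice _ _ _ hg.continuous hgc]
  have hneg : ∀ u : L2q, ∫ q, (g q : ℂ) * (-u : L2q) q = -∫ q, (g q : ℂ) * u q := by
    intro u
    rw [← integral_neg]
    apply integral_congr_ae
    filter_upwards [Lp.coeFn_neg u] with q hq
    rw [hq, Pi.neg_apply, mul_neg]
  rw [hneg, integral_integral_mul_slice _ _ _ hg.continuous hgc, ← integral_neg]
  congr 1
  ext q
  rw [← mul_neg]
  congr 1
  have hsl : ContDiff ℝ 1 fun x => φ (x, q) := hφ.comp (contDiff_prodMk_left q)
  have hslc : HasCompactSupport fun x => φ (x, q) := by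
    refine HasCompactSupport.of_support_subset_isCompact (hc.image continuous_fst) ?_
    intro x hx
    exact ⟨(x, q), subset_tsupport _ hx, rfl⟩
  have hd : ∀ x, (∂_{v} θ) x = fderiv ℝ θ x v := fun x =>
    SchwartzMap.lineDerivOp_apply_eq_fderiv v θ x
  simp only [hd, ← fderiv_slice_apply hφ]
  have hθ := θ.continuous
  have hθ1 : ContDiff ℝ 1 θ := θ.smooth 1
  have hθ' : Continuous fun x => fderiv ℝ θ x v :=
    (hθ1.continuous_fderiv one_ne_zero).clm_apply continuous_const
  have hs' : Continuous fun x => fderiv ℝ (fun x => φ (x, q)) x v :=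
    (hsl.continuous_fderiv one_ne_zero).clm_apply continuous_const
  apply integral_mul_fderiv_eq_neg_fderiv_mul_of_integrable
  · exact (hθ'.mul hsl.continuous).integrable_of_hasCompactSupport hslc.mul_left
  · exact (hθ.mul hs').integrable_of_hasCompactSupport (hslc.fderiv_apply ℝ v).mul_left
  · exact (hθ.mul hsl.continuous).integrable_of_hasCompactSupport hslc.mul_left
  · exact fun x _ => hθ1.differentiable one_ne_zero x
  · exact fun x _ => hsl.differentiable one_ne_zero x

/-- The Fourier transform turns position derivatives of test functions into multiplications. -/
theorem fourier_testLp_posDeriv {φ : E3 × E3 → ℂ} (hφ : ContDiff ℝ 1 φ)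
    (hc : HasCompactSupport φ) (v : E3) :
    ((𝓕 (testLp (posDeriv v φ) (continuous_posDeriv hφ v) (hasCompactSupport_posDeriv hc v)) :
      L2xq) : E3 → L2q) =ᵐ[volume] fun ξ =>
        (2 * Real.pi * Complex.I * (inner ℝ ξ v : ℝ)) •
          (𝓕 (testLp φ hφ.continuous hc) : L2xq) ξ := by
  set F : L2xq := 𝓕 (testLp φ hφ.continuous hc) with hF
  have hloc : LocallyIntegrable (fun ξ : E3 => F ξ) volume :=
    (Lp.memLp F).locallyIntegrable (by norm_num)
  refine ae_eq_of_integral_contDiff_smul_eq ((Lp.memLp _).locallyIntegrable (by norm_num)) ?_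
    fun g hg hgc => ?_
  · rw [← locallyIntegrableOn_univ] at hloc ⊢
    exact hloc.continuousOn_smul
      (g := fun ξ : E3 => (2 * Real.pi * Complex.I * (inner ℝ ξ v : ℝ) : ℂ))
      isOpen_univ.isLocallyClosed (by fun_prop)
  · have hg1 : HasCompactSupport (Complex.ofRealCLM ∘ g) := hgc.comp_left rfl
    have hg2 : ContDiff ℝ ∞ (Complex.ofRealCLM ∘ g) := by fun_prop
    -- The localising function `g` is itself a Schwartz function, so the transform can be moved onto
    -- it.
    set θ : 𝓢(E3, ℂ) := hg1.toSchwartzMap hg2 with hθ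
    have hθg : ∀ ξ, θ ξ = (g ξ : ℂ) := fun ξ => rfl
    have htg : (fun y : E3 => inner ℝ y v).HasTemperateGrowth := by fun_prop
    have hl : ∀ (u : L2xq), ∫ ξ, g ξ • u ξ = ∫ ξ, θ ξ • u ξ := fun u => by
      
      refine integral_congr_ae (Eventually.of_forall fun ξ => ?_)
      exact RCLike.real_smul_eq_coe_smul (K := ℂ) _ _
    rw [hl, integral_smul_fourier]
    have h1 : ∫ x, (𝓕 θ) x • (testLp (posDeriv v φ) (continuous_posDeriv hφ v)
        (hasCompactSupport_posDeriv hc v)) x = ∫ x, (𝓕 θ) x • slice (posDeriv v φ)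
          (continuous_posDeriv hφ v) (hasCompactSupport_posDeriv hc v) x := by
      apply integral_congr_ae
      filter_upwards [testLp_coeFn (continuous_posDeriv hφ v) (hasCompactSupport_posDeriv hc v)]
        with x hx
      rw [hx]
    have h2 : ∫ x, (∂_{v} (𝓕 θ)) x • slice φ hφ.continuous hc x
        = ∫ x, (∂_{v} (𝓕 θ)) x • testLp φ hφ.continuous hc x := by
      apply integral_congr_ae
      filter_upwards [testLp_coeFn hφ.continuous hc] with x hx
      rw [hx]
    -- Differentiating `𝓕 θ` brings down `-2πi ⟨ξ, v⟩`; its sign cancels the one from integration by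
    -- parts.
    rw [h1, integral_smul_slice_posDeriv hφ hc, h2, SchwartzMap.lineDerivOp_fourier_eq,
      ← integral_smul_fourier, ← integral_neg]
    congr 1
    ext1 ξ
    simp only [smul_apply, SchwartzMap.smulLeftCLM_apply_apply htg, hθg]
    rw [RCLike.real_smul_eq_coe_smul (K := ℂ) (g ξ), ← hF, smul_smul, ← neg_smul]
    congr 1
    simp only [smul_eq_mul, Complex.real_smul, Complex.coe_algebraMap]
    ring

/-! ### The weak formulation as a continuous functional -/

theorem inner_L2xq (f g : L2xq) : (inner ℂ f g : ℂ) = ∫ x, inner ℂ (f x) (g x) := L2.inner_def f g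

theorem inner_testLp {φ : E3 × E3 → ℂ} (hφ : Continuous φ) (hc : HasCompactSupport φ) (g : L2xq) :
    (inner ℂ (testLp φ hφ hc) g : ℂ) = ∫ x, inner ℂ (slice φ hφ hc x) (g x) := by
  rw [L2.inner_def]
  apply integral_congr_ae
  filter_upwards [testLp_coeFn hφ hc] with x hx
  rw [hx]

/-- The inner product is conjugate linear in its first argument, whereas the weak formulation is
bilinear; hence the conjugate test functions in what follows. -/
theorem inner_slice {φ : E3 × E3 → ℂ} (hφ : Continuous φ) (hc : HasCompactSupport φ) (x : E3)
    (u : L2q) : (inner ℂ (slice φ hφ hc x) u : ℂ) = ∫ q, u q * (starRingEnd ℂ) (φ (x, q)) := by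
  rw [L2.inner_def]
  apply integral_congr_ae
  filter_upwards [slice_coeFn hφ hc x] with q hq
  rw [hq, RCLike.inner_apply]

theorem integrable_inner_slice {φ : E3 × E3 → ℂ} (hφ : Continuous φ) (hc : HasCompactSupport φ)
    (x : E3) (u : L2q) : Integrable fun q => u q * (starRingEnd ℂ) (φ (x, q)) := by
  refine (L2.integrable_inner (𝕜 := ℂ) (slice φ hφ hc x) u).congr ?_
  filter_upwards [slice_coeFn hφ hc x] with q hq
  rw [hq, RCLike.inner_apply]

/-- The complex conjugate of a test function. -/
noncomputable def conjTest (φ : E3 × E3 → ℂ) (z : E3 × E3) : ℂ := (starRingEnd ℂ) (φ z)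

theorem conjTest_conjTest (φ : E3 × E3 → ℂ) : conjTest (conjTest φ) = φ := by
  funext z
  simp [conjTest]

theorem contDiff_conjTest {φ : E3 × E3 → ℂ} {n : ℕ∞ω} (hφ : ContDiff ℝ n φ) :
    ContDiff ℝ n (conjTest φ) :=
  Complex.conjCLE.contDiff.comp hφ

theorem hasCompactSupport_conjTest {φ : E3 × E3 → ℂ} (hc : HasCompactSupport φ) :
    HasCompactSupport (conjTest φ) :=
  hc.comp_left (g := starRingEnd ℂ) (map_zero _)

theorem fderiv_conjTest {φ : E3 × E3 → ℂ} (hφ : ContDiff ℝ 1 φ) (z w : E3 × E3) :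
    fderiv ℝ (conjTest φ) z w = (starRingEnd ℂ) (fderiv ℝ φ z w) := by
  have h1 := ((hφ.differentiable one_ne_zero) z).hasFDerivAt
  have h2 := (Complex.conjCLE.toContinuousLinearMap.hasFDerivAt).comp z h1
  have h3 : fderiv ℝ (conjTest φ) z
      = Complex.conjCLE.toContinuousLinearMap.comp (fderiv ℝ φ z) := h2.fderiv
  rw [h3]
  rfl

/-- The right-hand side of the weak formulation as a functional of the solution; the functional is
conjugate linear in `φ`. -/
noncomputable def weakForm (β : ℝ) (hβ : 0 < β) (φ : E3 × E3 → ℂ) (hφ : ContDiff ℝ 1 φ)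
    (hc : HasCompactSupport φ) : L2xq →L[ℂ] ℂ :=
  ∑ i : Fin 3, (innerSL ℂ (testLp (posDeriv (EuclideanSpace.single i 1) φ)
      (continuous_posDeriv hφ _) (hasCompactSupport_posDeriv hc _))).comp
        ((velMul i).compLpL 2 volume)
    + (innerSL ℂ (testLp φ hφ.continuous hc)).comp ((fiberGenerator β hβ 0).compLpL 2 volume)

theorem weakForm_apply (β : ℝ) (hβ : 0 < β) {φ : E3 × E3 → ℂ} (hφ : ContDiff ℝ 1 φ)
    (hc : HasCompactSupport φ) (g : L2xq) :
    weakForm β hβ φ hφ hc g = ∑ i : Fin 3, inner ℂ (testLp (posDeriv (EuclideanSpace.single i 1) φ)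
      (continuous_posDeriv hφ _) (hasCompactSupport_posDeriv hc _)) ((velMul i).compLpL 2 volume g)
    + inner ℂ (testLp φ hφ.continuous hc) ((fiberGenerator β hβ 0).compLpL 2 volume g) := by
  simp [weakForm]

theorem linL_ae_eq (β : ℝ) (hβ : 0 < β) (u : L2q) :
    (fiberGenerator β hβ 0 u : E3 → ℂ) =ᵐ[volume] linL β u := by
  filter_upwards [fiberGenerator_coeFn β hβ 0 u] with q hq
  rw [hq]
  simp

theorem velocity_prod_eq_sum (q : E3) : ((velocity q, 0) : E3 × E3)
    = ∑ i : Fin 3, velocity q i • ((EuclideanSpace.single i (1 : ℝ), 0) : E3 × E3) := by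
  have h : velocity q = ∑ i : Fin 3, velocity q i • EuclideanSpace.single i (1 : ℝ) := by
    ext j
    fin_cases j <;> simp [Fin.sum_univ_three]
  apply Prod.ext
  · rw [Prod.fst_sum]
    exact h
  · rw [Prod.snd_sum]
    simp

/-- Expanding `q̂·∇_x` in coordinates puts the derivatives on `φ` and leaves the bounded
multiplications `q̂ᵢ` on `g`. Thus the right-hand side of the weak formulation is a continuous
functional on `L²`, which can be exchanged with time integrals. -/
theorem weakForm_eq_integral (β : ℝ) (hβ : 0 < β) {φ : E3 × E3 → ℂ} (hφ : ContDiff ℝ 1 φ)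
    (hc : HasCompactSupport φ) (g : L2xq) :
    weakForm β hβ φ hφ hc g = ∫ x, ∫ q, (g x q * fderiv ℝ (conjTest φ) (x, q) (velocity q, 0)
      + linL β (g x) q * conjTest φ (x, q)) := by
  have hs := fun i => L2.integrable_inner (𝕜 := ℂ) (testLp (posDeriv (EuclideanSpace.single i 1) φ)
      (continuous_posDeriv hφ _) (hasCompactSupport_posDeriv hc _)) ((velMul i).compLpL 2 volume g)
  have hs0 := L2.integrable_inner (𝕜 := ℂ) (testLp φ hφ.continuous hc)
    ((fiberGenerator β hβ 0).compLpL 2 volume g)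
  rw [weakForm_apply]
  simp only [inner_L2xq]
  rw [← integral_finsetSum _ fun i _ => hs i, ← integral_add (integrable_finsetSum _ fun i _ => hs i)
    hs0]
  apply integral_congr_ae
  have hae : ∀ᵐ x : E3, ∀ i : Fin 3, testLp (posDeriv (EuclideanSpace.single i 1) φ)
      (continuous_posDeriv hφ _) (hasCompactSupport_posDeriv hc _) x
        = slice (posDeriv (EuclideanSpace.single i 1) φ)
      (continuous_posDeriv hφ _) (hasCompactSupport_posDeriv hc _) x
      ∧ (velMul i).compLpL 2 volume g x = velMul i (g x) := by
    rw [ae_all_iff]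
    intro i
    filter_upwards [testLp_coeFn (continuous_posDeriv hφ (EuclideanSpace.single i 1))
      (hasCompactSupport_posDeriv hc _), (velMul i).coeFn_compLpL g] with x h1 h2
    exact ⟨h1, h2⟩
  filter_upwards [hae, testLp_coeFn hφ.continuous hc, (fiberGenerator β hβ 0).coeFn_compLpL g]
    with x h1 h2 h3
  rw [h2, h3, Finset.sum_congr rfl fun i _ => by rw [(h1 i).1, (h1 i).2]]
  simp only [inner_slice]
  have hi := fun i : Fin 3 => integrable_inner_slice (continuous_posDeriv hφ
    (EuclideanSpace.single i 1)) (hasCompactSupport_posDeriv hc _) x (velMul i (g x))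
  have hi0 := integrable_inner_slice hφ.continuous hc x (fiberGenerator β hβ 0 (g x))
  rw [← integral_finsetSum _ fun i _ => hi i, ← integral_add (integrable_finsetSum _ fun i _ => hi i)
    hi0]
  apply integral_congr_ae
  have hae2 : ∀ᵐ q : E3, ∀ i : Fin 3, velMul i (g x) q = ((velocity q i : ℝ) : ℂ) * g x q := by
    rw [ae_all_iff]
    exact fun i => velMul_coeFn i (g x)
  filter_upwards [hae2, linL_ae_eq β hβ (g x)] with q h4 h5
  rw [h5, velocity_prod_eq_sum, map_sum, Finset.mul_sum]
  congr 1
  refine Finset.sum_congr rfl fun i _ => ?_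
  rw [h4, map_smul, fderiv_conjTest hφ, posDeriv, Complex.real_smul]
  ring

theorem inner_testLp_eq_integral {φ : E3 × E3 → ℂ} (hφ : Continuous φ) (hc : HasCompactSupport φ)
    (g : L2xq) :
    (inner ℂ (testLp φ hφ hc) g : ℂ) = ∫ x, ∫ q, g x q * conjTest φ (x, q) := by
  rw [inner_testLp]
  simp only [inner_slice]
  rfl

/-- In terms of the Fourier transform the weak form is the pairing with the fibre generators. -/
theorem inner_fiberGenerator_fourier (β : ℝ) (hβ : 0 < β) {φ : E3 × E3 → ℂ} (hφ : ContDiff ℝ 1 φ)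
    (hc : HasCompactSupport φ) :
    ∀ᵐ ξ : E3, ∀ u : L2q,
      inner ℂ ((𝓕 (testLp φ hφ.continuous hc) : L2xq) ξ)
        (fiberGenerator β hβ ((2 * Real.pi) • ξ) u)
      = ∑ i : Fin 3, inner ℂ ((𝓕 (testLp (posDeriv (EuclideanSpace.single i 1) φ)
        (continuous_posDeriv hφ _) (hasCompactSupport_posDeriv hc _)) : L2xq) ξ) (velMul i u)
        + inner ℂ ((𝓕 (testLp φ hφ.continuous hc) : L2xq) ξ) (fiberGenerator β hβ 0 u) := by
  have hae : ∀ᵐ ξ : E3, ∀ i : Fin 3, (𝓕 (testLp (posDeriv (EuclideanSpace.single i 1) φ)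
        (continuous_posDeriv hφ _) (hasCompactSupport_posDeriv hc _)) : L2xq) ξ
        = (2 * Real.pi * Complex.I * (ξ i : ℝ)) •
          (𝓕 (testLp φ hφ.continuous hc) : L2xq) ξ := by
    rw [ae_all_iff]
    intro i
    filter_upwards [fourier_testLp_posDeriv hφ hc (EuclideanSpace.single i 1)] with ξ hξ
    rw [hξ, EuclideanSpace.inner_single_right]
    simp
  filter_upwards [hae] with ξ hξ u
  rw [fiberGenerator_eq, sub_apply, sum_apply, inner_sub_right, inner_sum, sub_eq_neg_add,
    ← Finset.sum_neg_distrib]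
  congr 1
  refine Finset.sum_congr rfl fun i _ => ?_
  -- The factor `2πi ξᵢ` from differentiating the test function leaves the first slot conjugated, as
  -- `-2πi ξᵢ = -i ζᵢ`, the coefficient in the generator.
  rw [hξ i, smul_apply, inner_smul_right, inner_smul_left]
  simp only [PiLp.smul_apply, smul_eq_mul, map_mul, Complex.conj_ofReal, Complex.conj_I,
    Complex.ofReal_mul, Complex.ofReal_ofNat, map_ofNat]
  ring

/-- Plancherel, together with the fact that operators acting in `q` commute with the transform in
`x`. -/
theorem weakForm_eq_fourier (β : ℝ) (hβ : 0 < β) {φ : E3 × E3 → ℂ} (hφ : ContDiff ℝ 1 φ)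
    (hc : HasCompactSupport φ) (g : L2xq) :
    weakForm β hβ φ hφ hc g = ∫ ξ, inner ℂ ((𝓕 (testLp φ hφ.continuous hc) : L2xq) ξ)
        (fiberGenerator β hβ ((2 * Real.pi) • ξ) ((𝓕 g : L2xq) ξ)) := by
  rw [weakForm_apply]
  simp only [← Lp.inner_fourier_eq (testLp _ _ _), fourier_compLpL]
  have hs := fun i => L2.integrable_inner (𝕜 := ℂ)
    (𝓕 (testLp (posDeriv (EuclideanSpace.single i 1) φ)
      (continuous_posDeriv hφ _) (hasCompactSupport_posDeriv hc _)) : L2xq)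
    ((velMul i).compLpL 2 volume (𝓕 g : L2xq))
  have hs0 := L2.integrable_inner (𝕜 := ℂ) (𝓕 (testLp φ hφ.continuous hc) : L2xq)
    ((fiberGenerator β hβ 0).compLpL 2 volume (𝓕 g : L2xq))
  simp only [inner_L2xq]
  rw [← integral_finsetSum _ fun i _ => hs i, ← integral_add (integrable_finsetSum _ fun i _ => hs i)
    hs0]
  apply integral_congr_ae
  have hae : ∀ᵐ ξ : E3, ∀ i : Fin 3,
      (velMul i).compLpL 2 volume (𝓕 g : L2xq) ξ = velMul i ((𝓕 g : L2xq) ξ) := by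
    rw [ae_all_iff]
    exact fun i => (velMul i).coeFn_compLpL _
  filter_upwards [inner_fiberGenerator_fourier β hβ hφ hc, hae,
    (fiberGenerator β hβ 0).coeFn_compLpL (𝓕 g : L2xq)] with ξ h1 h2 h3
  rw [h1, h3]
  congr 1
  exact Finset.sum_congr rfl fun i _ => by rw [h2 i]

/-- An integrable bound for the pairing with the fibre generators. -/
theorem exists_bound_inner_fiberGenerator (β : ℝ) (hβ : 0 < β) {φ : E3 × E3 → ℂ}
    (hφ : ContDiff ℝ 1 φ) (hc : HasCompactSupport φ) :
    ∃ b : E3 → ℝ, MemLp b 2 volume ∧ ∀ᵐ ξ : E3, ∀ u : L2q,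
      ‖(inner ℂ ((𝓕 (testLp φ hφ.continuous hc) : L2xq) ξ)
        (fiberGenerator β hβ ((2 * Real.pi) • ξ) u) : ℂ)‖ ≤ b ξ * ‖u‖ := by
  -- The linear growth of the generator in `ξ` is absorbed by the transforms of the derivatives of
  -- `φ`, which are still in `L²`.
  refine ⟨fun ξ => ∑ i : Fin 3, ‖velMul i‖ * ‖(𝓕 (testLp (posDeriv (EuclideanSpace.single i 1) φ)
        (continuous_posDeriv hφ _) (hasCompactSupport_posDeriv hc _)) : L2xq) ξ‖
      + ‖fiberGenerator β hβ 0‖ * ‖(𝓕 (testLp φ hφ.continuous hc) : L2xq) ξ‖, ?_, ?_⟩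
  · refine MemLp.add (memLp_finsetSum _ fun i _ => ?_) ?_
    · exact ((Lp.memLp _).norm).const_mul _
    · exact ((Lp.memLp _).norm).const_mul _
  · filter_upwards [inner_fiberGenerator_fourier β hβ hφ hc] with ξ hξ u
    rw [hξ u, add_mul, Finset.sum_mul]
    refine (norm_add_le _ _).trans (add_le_add ((norm_sum_le _ _).trans
      (Finset.sum_le_sum fun i _ => ?_)) ?_)
    · refine (norm_inner_le_norm _ _).trans ?_
      calc _ ≤ ‖(𝓕 (testLp (posDeriv (EuclideanSpace.single i 1) φ)
        (continuous_posDeriv hφ _) (hasCompactSupport_posDeriv hc _)) : L2xq) ξ‖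
          * (‖velMul i‖ * ‖u‖) := by gcongr; exact (velMul i).le_opNorm u
        _ = _ := by ring
    · refine (norm_inner_le_norm _ _).trans ?_
      calc _ ≤ ‖(𝓕 (testLp φ hφ.continuous hc) : L2xq) ξ‖
          * (‖fiberGenerator β hβ 0‖ * ‖u‖) := by
            gcongr; exact (fiberGenerator β hβ 0).le_opNorm u
        _ = _ := by ring

/-! ### The semigroup on the Fourier side -/

/-- The propagator `exp(t B̂(ζ))`, frozen at the identity for negative times. -/
noncomputable def propagator (β : ℝ) (hβ : 0 < β) (t : ℝ) (ζ : E3) : L2q →L[ℂ] L2q :=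
  NormedSpace.exp (((max t 0 : ℝ) : ℂ) • fiberGenerator β hβ ζ)

theorem propagator_of_nonneg (β : ℝ) (hβ : 0 < β) {t : ℝ} (ht : 0 ≤ t) (ζ : E3) :
    propagator β hβ t ζ = NormedSpace.exp ((t : ℂ) • fiberGenerator β hβ ζ) := by
  rw [propagator, max_eq_left ht]

theorem propagator_zero (β : ℝ) (hβ : 0 < β) (ζ : E3) (v : L2q) : propagator β hβ 0 ζ v = v := by
  simp [propagator]

/-- Freezing at negative times gives the bound for all real `t`, so limits at `t = 0` can be taken
from both sides. -/
theorem norm_propagator_apply_le {β : ℝ} (hβ : 0 < β) (t : ℝ) (ζ : E3) (v : L2q) :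
    ‖propagator β hβ t ζ v‖ ≤ ‖v‖ :=
  norm_exp_fiberGenerator_apply_le hβ ζ v (le_max_right _ _)

theorem continuous_propagator_apply {β : ℝ} (hβ : 0 < β) (ζ : E3) (v : L2q) :
    Continuous fun t => propagator β hβ t ζ v := by
  have h : Continuous fun s : ℝ => NormedSpace.exp ((s : ℂ) • fiberGenerator β hβ ζ) v :=
    continuous_iff_continuousAt.2 fun s => (hasDerivAt_exp_smul_apply _ v s).continuousAt
  exact h.comp (by fun_prop : Continuous fun t : ℝ => max t 0)

theorem hasDerivAt_propagator_apply {β : ℝ} (hβ : 0 < β) (ζ : E3) (v : L2q) {t : ℝ} (ht : 0 < t) :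
    HasDerivAt (fun t => propagator β hβ t ζ v)
      (fiberGenerator β hβ ζ (propagator β hβ t ζ v)) t := by
  have h := hasDerivAt_exp_smul_apply (fiberGenerator β hβ ζ) v t
  rw [propagator_of_nonneg β hβ ht.le]
  refine h.congr_of_eventuallyEq ?_
  filter_upwards [lt_mem_nhds ht] with s hs
  rw [propagator_of_nonneg β hβ hs.le]

theorem aestronglyMeasurable_clm_apply {A : E3 → L2q →L[ℂ] L2q} (hA : Continuous A) {v : E3 → L2q}
    (hv : AEStronglyMeasurable v volume) : AEStronglyMeasurable (fun ξ => A ξ (v ξ)) volume :=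
  (isBoundedBilinearMap_apply (𝕜 := ℂ) (E := L2q) (F := L2q)).continuous.comp_aestronglyMeasurable
    (hA.aestronglyMeasurable.prodMk hv)

theorem stronglyMeasurable_propagator {β : ℝ} (hβ : 0 < β) (t c : ℝ) {v : E3 → L2q}
    (hv : StronglyMeasurable v) :
    StronglyMeasurable fun ξ => propagator β hβ t (c • ξ) (v ξ) :=
  (isBoundedBilinearMap_apply (𝕜 := ℂ) (E := L2q) (F := L2q)).continuous.comp_stronglyMeasurable
    ((continuous_exp_fiberGenerator β hβ _ c).stronglyMeasurable.prodMk hv)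

theorem aestronglyMeasurable_propagator {β : ℝ} (hβ : 0 < β) (t c : ℝ) {v : E3 → L2q}
    (hv : AEStronglyMeasurable v volume) :
    AEStronglyMeasurable (fun ξ => propagator β hβ t (c • ξ) (v ξ)) volume :=
  aestronglyMeasurable_clm_apply (continuous_exp_fiberGenerator β hβ _ c) hv

/-- Strong continuity of the propagator in weighted `L²` spaces. -/
theorem tendsto_eLpNorm_propagator {β : ℝ} (hβ : 0 < β) (c : ℝ) {v : E3 → L2q}
    (hv : StronglyMeasurable v) {w : E3 → ℝ} (hw : Continuous w)
    (hfin : eLpNorm (fun ξ => w ξ * ‖v ξ‖) 2 volume < ⊤) (t₀ : ℝ) :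
    Tendsto (fun t => eLpNorm (fun ξ => w ξ * ‖propagator β hβ t (c • ξ) (v ξ)
      - propagator β hβ t₀ (c • ξ) (v ξ)‖) 2 volume) (𝓝 t₀) (𝓝 0) := by
  have hexp : ∀ t, eLpNorm (fun ξ => w ξ * ‖propagator β hβ t (c • ξ) (v ξ)
      - propagator β hβ t₀ (c • ξ) (v ξ)‖) 2 volume
      = (∫⁻ ξ, ‖w ξ * ‖propagator β hβ t (c • ξ) (v ξ)
      - propagator β hβ t₀ (c • ξ) (v ξ)‖‖ₑ ^ (2 : ℝ)) ^ (1 / 2 : ℝ) := by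
    intro t
    rw [eLpNorm_eq_lintegral_rpow_enorm_toReal (by norm_num) (by norm_num)]
    simp
  simp only [hexp]
  have hlim : Tendsto (fun t => ∫⁻ ξ, ‖w ξ * ‖propagator β hβ t (c • ξ) (v ξ)
      - propagator β hβ t₀ (c • ξ) (v ξ)‖‖ₑ ^ (2 : ℝ)) (𝓝 t₀) (𝓝 (∫⁻ _ : E3, 0)) := by
    -- Contractivity gives the time-independent majorant `2 w ‖v‖`; pointwise convergence is
    -- continuity of each propagator in `t`.
    refine tendsto_lintegral_filter_of_dominated_convergence
      (fun ξ => ‖2 * (w ξ * ‖v ξ‖)‖ₑ ^ (2 : ℝ)) (Eventually.of_forall fun t => ?_)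
      (Eventually.of_forall fun t => Eventually.of_forall fun ξ => ?_) ?_
      (Eventually.of_forall fun ξ => ?_)
    · have h1 := (stronglyMeasurable_propagator hβ t c hv).sub
        (stronglyMeasurable_propagator hβ t₀ c hv)
      exact ((hw.stronglyMeasurable.mul h1.norm).enorm).pow_const _
    · refine ENNReal.rpow_le_rpow ?_ (by norm_num)
      rw [enorm_le_iff_norm_le, norm_mul, norm_mul, norm_mul, norm_norm, norm_norm]
      have h2 : ‖propagator β hβ t (c • ξ) (v ξ) - propagator β hβ t₀ (c • ξ) (v ξ)‖
          ≤ ‖v ξ‖ + ‖v ξ‖ := (norm_sub_le _ _).trans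
        (add_le_add (norm_propagator_apply_le hβ _ _ _) (norm_propagator_apply_le hβ _ _ _))
      calc ‖w ξ‖ * _ ≤ ‖w ξ‖ * (‖v ξ‖ + ‖v ξ‖) := by gcongr
        _ = ‖(2 : ℝ)‖ * (‖w ξ‖ * ‖v ξ‖) := by
          rw [Real.norm_ofNat]; ring
    · have h3 : eLpNorm (fun ξ => 2 * (w ξ * ‖v ξ‖)) 2 volume < ⊤ := by
        have h4 := eLpNorm_const_smul (2 : ℝ) (fun ξ => w ξ * ‖v ξ‖) 2 (volume : Measure E3)
        have h5 : eLpNorm (fun ξ => 2 * (w ξ * ‖v ξ‖)) 2 volume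
            = ‖(2 : ℝ)‖ₑ * eLpNorm (fun ξ => w ξ * ‖v ξ‖) 2 volume := h4
        rw [h5]
        exact ENNReal.mul_lt_top enorm_lt_top hfin
      have h6 := lintegral_rpow_enorm_lt_top_of_eLpNorm_lt_top (by norm_num) (by norm_num) h3
      simpa using h6.ne
    · have h7 := ((continuous_propagator_apply hβ (c • ξ) (v ξ)).tendsto t₀).sub_const
        (propagator β hβ t₀ (c • ξ) (v ξ))
      rw [sub_self] at h7
      have h8 := (h7.norm.const_mul (w ξ)).enorm
      rw [norm_zero, mul_zero, enorm_zero] at h8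
      have h9 := (ENNReal.continuous_rpow_const (y := 2)).tendsto 0 |>.comp h8
      simpa [Function.comp_def] using h9
  rw [lintegral_zero] at hlim
  have h10 := (ENNReal.continuous_rpow_const (y := 1 / 2)).tendsto 0 |>.comp hlim
  simpa [Function.comp_def] using h10

theorem memLp_propagator {β : ℝ} (hβ : 0 < β) (t c : ℝ) (F : L2xq) :
    MemLp (fun ξ => propagator β hβ t (c • ξ) (F ξ)) 2 volume :=
  (Lp.memLp F).of_le (aestronglyMeasurable_propagator hβ t c (Lp.memLp F).1)
    (Eventually.of_forall fun _ => norm_propagator_apply_le hβ _ _ _)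

/-- The evolution on the Fourier side. -/
noncomputable def evolHat (β : ℝ) (hβ : 0 < β) (F : L2xq) (t : ℝ) : L2xq :=
  (memLp_propagator hβ t (2 * Real.pi) F).toLp _

theorem evolHat_coeFn (β : ℝ) (hβ : 0 < β) (F : L2xq) (t : ℝ) :
    (evolHat β hβ F t : E3 → L2q) =ᵐ[volume]
      fun ξ => propagator β hβ t ((2 * Real.pi) • ξ) (F ξ) :=
  (memLp_propagator hβ t (2 * Real.pi) F).coeFn_toLp

theorem evolHat_zero (β : ℝ) (hβ : 0 < β) (F : L2xq) : evolHat β hβ F 0 = F := by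
  apply Lp.ext
  filter_upwards [evolHat_coeFn β hβ F 0] with ξ hξ
  rw [hξ, propagator_zero]

theorem continuous_evolHat (β : ℝ) (hβ : 0 < β) (F : L2xq) : Continuous (evolHat β hβ F) := by
  rw [continuous_iff_continuousAt]
  intro t₀
  rw [ContinuousAt, Lp.tendsto_Lp_iff_tendsto_eLpNorm']
  have h := tendsto_eLpNorm_propagator hβ (2 * Real.pi) (Lp.stronglyMeasurable F) (w := fun _ => 1)
    continuous_const (by simpa using (Lp.memLp F).2) t₀
  refine h.congr fun t => ?_
  simp only [one_mul]
  rw [eLpNorm_norm (f := fun ξ => propagator β hβ t ((2 * Real.pi) • ξ) (F ξ)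
    - propagator β hβ t₀ ((2 * Real.pi) • ξ) (F ξ))]
  apply eLpNorm_congr_ae
  filter_upwards [evolHat_coeFn β hβ F t, evolHat_coeFn β hβ F t₀] with ξ h1 h2
  rw [Pi.sub_apply, h1, h2]

/-- The solution `f(t) = e^{tB} f₀`. -/
noncomputable def evol (β : ℝ) (hβ : 0 < β) (f₀ : L2xq) (t : ℝ) : L2xq :=
  𝓕⁻ (evolHat β hβ (𝓕 f₀) t)

theorem fourier_evol (β : ℝ) (hβ : 0 < β) (f₀ : L2xq) (t : ℝ) :
    (𝓕 (evol β hβ f₀ t) : L2xq) = evolHat β hβ (𝓕 f₀) t :=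
  FourierTransform.fourier_fourierInv_eq _

theorem evol_zero (β : ℝ) (hβ : 0 < β) (f₀ : L2xq) : evol β hβ f₀ 0 = f₀ := by
  rw [evol, evolHat_zero]
  exact FourierTransform.fourierInv_fourier_eq f₀

theorem continuous_evol (β : ℝ) (hβ : 0 < β) (f₀ : L2xq) : Continuous (evol β hβ f₀) :=
  (Lp.fourierTransformₗᵢ E3 L2q).symm.continuous.comp (continuous_evolHat β hβ (𝓕 f₀))

/-- Differentiation under the frequency integral. The majorant `b ‖F‖` is a product of two `L²`
functions, independent of time by contractivity, so no regularity of `f₀` is required. -/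
theorem hasDerivAt_inner_evol (β : ℝ) (hβ : 0 < β) {φ : E3 × E3 → ℂ} (hφ : ContDiff ℝ 1 φ)
    (hc : HasCompactSupport φ) (f₀ : L2xq) {t : ℝ} (ht : 0 < t) :
    HasDerivAt (fun t => (inner ℂ (testLp φ hφ.continuous hc) (evol β hβ f₀ t) : ℂ))
      (weakForm β hβ φ hφ hc (evol β hβ f₀ t)) t := by
  set Φ : L2xq := 𝓕 (testLp φ hφ.continuous hc) with hΦ
  set F : L2xq := 𝓕 f₀ with hF
  obtain ⟨b, hb, hbound⟩ := exists_bound_inner_fiberGenerator β hβ hφ hc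
  have h1 : ∀ s, (inner ℂ (testLp φ hφ.continuous hc) (evol β hβ f₀ s) : ℂ)
      = ∫ ξ, inner ℂ (Φ ξ) (propagator β hβ s ((2 * Real.pi) • ξ) (F ξ)) := by
    intro s
    rw [← Lp.inner_fourier_eq, fourier_evol, inner_L2xq]
    apply integral_congr_ae
    filter_upwards [evolHat_coeFn β hβ F s] with ξ hξ
    rw [hξ]
  have h2 : weakForm β hβ φ hφ hc (evol β hβ f₀ t) = ∫ ξ, inner ℂ (Φ ξ)
      (fiberGenerator β hβ ((2 * Real.pi) • ξ)
        (propagator β hβ t ((2 * Real.pi) • ξ) (F ξ))) := by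
    rw [weakForm_eq_fourier, fourier_evol]
    apply integral_congr_ae
    filter_upwards [evolHat_coeFn β hβ F t] with ξ hξ
    rw [hξ]
  simp only [h1, h2]
  have hm : ∀ s, AEStronglyMeasurable
      (fun ξ => propagator β hβ s ((2 * Real.pi) • ξ) (F ξ)) volume := fun s =>
    aestronglyMeasurable_propagator hβ s _ (Lp.memLp F).1
  have hG : Continuous fun ξ : E3 => fiberGenerator β hβ ((2 * Real.pi) • ξ) :=
    (continuous_fiberGenerator β hβ).comp (continuous_const_smul _)
  refine (hasDerivAt_integral_of_dominated_loc_of_deriv_le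
    (F' := fun s ξ => inner ℂ (Φ ξ) (fiberGenerator β hβ ((2 * Real.pi) • ξ)
      (propagator β hβ s ((2 * Real.pi) • ξ) (F ξ))))
    (bound := fun ξ => b ξ * ‖F ξ‖) (s := Set.Ioi 0) (Ioi_mem_nhds ht)
    (Eventually.of_forall fun s => (Lp.memLp Φ).1.inner (hm s)) ?_
    ((Lp.memLp Φ).1.inner (aestronglyMeasurable_clm_apply hG (hm t))) ?_ ?_ ?_).2
  · refine (L2.integrable_inner (𝕜 := ℂ) Φ (evolHat β hβ F t)).congr ?_
    filter_upwards [evolHat_coeFn β hβ F t] with ξ hξ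
    rw [hξ]
  · filter_upwards [hbound] with ξ hξ s _
    refine (hξ _).trans ?_
    -- The sign of `b` can be read off from its bound wherever `F ξ ≠ 0`; elsewhere both sides
    -- vanish.
    have hb0 : 0 ≤ b ξ ∨ F ξ = 0 := by
      by_cases h0 : F ξ = 0
      · exact Or.inr h0
      · left
        have h3 := (norm_nonneg _).trans (hξ (F ξ))
        exact nonneg_of_mul_nonneg_left h3 (norm_pos_iff.2 h0)
    rcases hb0 with h0 | h0
    · exact mul_le_mul_of_nonneg_left (norm_propagator_apply_le hβ _ _ _) h0
    · simp [h0]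
  · exact hb.integrable_mul (Lp.memLp F).norm
  · refine Eventually.of_forall fun ξ s hs => ?_
    have h4 := (hasDerivAt_const s (Φ ξ)).inner ℂ
      (hasDerivAt_propagator_apply hβ ((2 * Real.pi) • ξ) (F ξ) (Set.mem_Ioi.1 hs))
    simpa using h4

theorem inner_testLp_evol (β : ℝ) (hβ : 0 < β) {φ : E3 × E3 → ℂ} (hφ : ContDiff ℝ 1 φ)
    (hc : HasCompactSupport φ) (f₀ : L2xq) {t : ℝ} (ht : 0 ≤ t) :
    (inner ℂ (testLp φ hφ.continuous hc) (evol β hβ f₀ t) : ℂ)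
      = inner ℂ (testLp φ hφ.continuous hc) f₀
        + ∫ s in (0 : ℝ)..t, weakForm β hβ φ hφ hc (evol β hβ f₀ s) := by
  have hcont : Continuous fun s => weakForm β hβ φ hφ hc (evol β hβ f₀ s) :=
    (weakForm β hβ φ hφ hc).continuous.comp (continuous_evol β hβ f₀)
  have hcont2 : Continuous fun s =>
      (inner ℂ (testLp φ hφ.continuous hc) (evol β hβ f₀ s) : ℂ) :=
    (innerSL ℂ (testLp φ hφ.continuous hc)).continuous.comp (continuous_evol β hβ f₀)
  rw [intervalIntegral.integral_eq_sub_of_hasDerivAt_of_le ht hcont2.continuousOn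
    (fun s hs => hasDerivAt_inner_evol β hβ hφ hc f₀ hs.1) (hcont.intervalIntegrable _ _),
    evol_zero]
  ring

/-- The weak formulation in terms of `L²` pairings. -/
theorem isWeakSolution_iff (β : ℝ) (hβ : 0 < β) (f₀ : L2xq) (f : ℝ → L2xq) :
    IsWeakSolution β f₀ f ↔ (∀ T : ℝ, 0 < T → IntegrableOn f (Set.Icc 0 T) volume) ∧
      ∀ (φ : E3 × E3 → ℂ) (hφ : ContDiff ℝ ∞ φ) (hc : HasCompactSupport φ) (t : ℝ), 0 ≤ t →
        (inner ℂ (testLp φ hφ.continuous hc) (f t) : ℂ)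
          = inner ℂ (testLp φ hφ.continuous hc) f₀
            + ∫ s in (0 : ℝ)..t, weakForm β hβ φ (hφ.of_le (by simp)) hc (f s) := by
  refine and_congr_right fun _ => ⟨fun h φ hφ hc t ht => ?_, fun h φ hφ hc t ht => ?_⟩
  · have := h (conjTest φ) (contDiff_conjTest hφ) (hasCompactSupport_conjTest hc) t ht
    simpa only [inner_testLp_eq_integral, weakForm_eq_integral] using this
  · have := h (conjTest φ) (contDiff_conjTest hφ) (hasCompactSupport_conjTest hc) t ht
    simpa only [inner_testLp_eq_integral, weakForm_eq_integral, conjTest_conjTest] using this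

theorem isWeakSolution_evol (β : ℝ) (hβ : 0 < β) (f₀ : L2xq) :
    IsWeakSolution β f₀ (evol β hβ f₀) := by
  rw [isWeakSolution_iff β hβ]
  exact ⟨fun T _ => (continuous_evol β hβ f₀).continuousOn.integrableOn_Icc,
    fun φ hφ hc t ht => inner_testLp_evol β hβ (hφ.of_le (by simp)) hc f₀ ht⟩

/-! ### Uniqueness -/

/-- Gronwall's inequality for the primitive `u` of `a`, which satisfies `u' ≤ C u` and `u(0) = 0`.
-/
theorem eq_zero_of_le_integral {a : ℝ → ℝ} (ha : Continuous a) (ha0 : ∀ t, 0 ≤ a t) {C T : ℝ}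
    (h : ∀ t ∈ Set.Icc 0 T, a t ≤ C * ∫ s in (0 : ℝ)..t, a s) : ∀ t ∈ Set.Icc 0 T, a t = 0 := by
  set u : ℝ → ℝ := fun t => ∫ s in (0 : ℝ)..t, a s with hu
  have hd : ∀ t, HasDerivAt u (a t) t := fun t =>
    intervalIntegral.integral_hasDerivAt_right (ha.intervalIntegrable _ _)
      (ha.stronglyMeasurableAtFilter _ _) ha.continuousAt
  have hupos : ∀ t ∈ Set.Icc 0 T, 0 ≤ u t := fun t ht =>
    intervalIntegral.integral_nonneg ht.1 fun s _ => ha0 s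
  have hg := norm_le_gronwallBound_of_norm_deriv_right_le (f := u) (f' := a) (δ := 0) (K := C)
    (ε := 0) (a := 0) (b := T) (fun t _ => (hd t).continuousAt.continuousWithinAt)
    (fun t _ => (hd t).hasDerivWithinAt) (by simp [hu]) (fun t ht => by
      have ht' : t ∈ Set.Icc 0 T := ⟨ht.1, ht.2.le⟩
      rw [Real.norm_of_nonneg (ha0 t), Real.norm_of_nonneg (hupos t ht'), add_zero]
      exact h t ht')
  intro t ht
  have h1 := hg t ht
  rw [gronwallBound_ε0_δ0] at h1
  have h2 : u t = 0 := norm_le_zero_iff.1 h1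
  have h3 := h t ht
  rw [show ∫ s in (0 : ℝ)..t, a s = 0 from h2, mul_zero] at h3
  exact le_antisymm h3 (ha0 t)

/-- The norm of `A ∫₀ᵗ w` is continuous and at most `∫₀ᵗ ‖A w‖`, so the hypothesis closes a Gronwall
loop. Only integrability of `w` enters; hence weak solutions need no continuity in time. -/
theorem map_integral_eq_zero {X Z : Type*} [NormedAddCommGroup X] [NormedSpace ℂ X]
    [CompleteSpace X] [NormedAddCommGroup Z] [NormedSpace ℂ Z] [CompleteSpace Z]
    (A : X →L[ℂ] Z) {w : ℝ → X} {T : ℝ} (hw : IntegrableOn w (Set.Icc 0 T)) {C : ℝ}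
    (h : ∀ s ∈ Set.Icc 0 T, ‖A (w s)‖ ≤ C * ‖A (∫ r in (0 : ℝ)..s, w r)‖) :
    ∀ t ∈ Set.Icc 0 T, A (∫ r in (0 : ℝ)..t, w r) = 0 := by
  -- The truncation is integrable on the whole line, so its primitive is continuous everywhere, and
  -- on `[0, T]` the primitive is unchanged.
  set v : ℝ → X := (Set.Icc 0 T).indicator w with hv
  have hvi : Integrable v := (integrable_indicator_iff measurableSet_Icc).2 hw
  have hcont : Continuous fun t => ∫ r in (0 : ℝ)..t, v r :=
    intervalIntegral.continuous_primitive (fun _ _ => hvi.intervalIntegrable) (0 : ℝ)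
  have heq : ∀ t ∈ Set.Icc 0 T, ∫ r in (0 : ℝ)..t, v r = ∫ r in (0 : ℝ)..t, w r := by
    intro t ht
    refine intervalIntegral.integral_congr fun s hs => ?_
    rw [Set.uIcc_of_le ht.1] at hs
    have hs' : s ∈ Set.Icc 0 T := ⟨hs.1, hs.2.trans ht.2⟩
    exact Set.indicator_of_mem hs' w
  have hacont : Continuous fun t => ‖A (∫ r in (0 : ℝ)..t, v r)‖ :=
    (A.continuous.comp hcont).norm
  have hzero := eq_zero_of_le_integral (C := C) (T := T) hacont (fun t => norm_nonneg _)
    (fun t ht => by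
      rw [← ContinuousLinearMap.intervalIntegral_comp_comm A hvi.intervalIntegrable,
        ← intervalIntegral.integral_const_mul]
      refine (intervalIntegral.norm_integral_le_integral_norm ht.1).trans ?_
      refine intervalIntegral.integral_mono_on ht.1
        (A.integrable_comp hvi).norm.intervalIntegrable
        ((hacont.const_mul C).intervalIntegrable _ _) fun s hs => ?_
      have hs' : s ∈ Set.Icc 0 T := ⟨hs.1, hs.2.trans ht.2⟩
      rw [heq s hs', hv, Set.indicator_of_mem hs']
      exact h s hs')
  intro t ht
  have := hzero t ht
  rw [heq t ht] at this
  exact norm_eq_zero.1 this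

/-! ### From product test functions to Schwartz functions of position. -/

/-- A function of the form `conj ψ(x) · g(q)` as a test function. -/
noncomputable def tensorTest (ψ : E3 → ℂ) (g : E3 → ℝ) (z : E3 × E3) : ℂ :=
  (starRingEnd ℂ) (ψ z.1) * (g z.2 : ℂ)

theorem contDiff_tensorTest {ψ : E3 → ℂ} {g : E3 → ℝ} (hψ : ContDiff ℝ ∞ ψ)
    (hg : ContDiff ℝ ∞ g) : ContDiff ℝ ∞ (tensorTest ψ g) := by
  have h1 : ContDiff ℝ ∞ fun z : E3 × E3 => (starRingEnd ℂ) (ψ z.1) :=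
    Complex.conjCLE.contDiff.comp (hψ.comp contDiff_fst)
  have h2 : ContDiff ℝ ∞ fun z : E3 × E3 => (g z.2 : ℂ) :=
    Complex.ofRealCLM.contDiff.comp (hg.comp contDiff_snd)
  exact h1.mul h2

theorem hasCompactSupport_tensorTest {ψ : E3 → ℂ} {g : E3 → ℝ} (hψ : HasCompactSupport ψ)
    (hg : HasCompactSupport g) : HasCompactSupport (tensorTest ψ g) := by
  refine HasCompactSupport.of_support_subset_isCompact (hψ.prod hg) ?_
  intro z hz
  refine ⟨subset_tsupport _ fun h0 => hz ?_, subset_tsupport _ fun h0 => hz ?_⟩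
  · simp [tensorTest, h0]
  · simp [tensorTest, h0]

theorem posDeriv_tensorTest {ψ : E3 → ℂ} {g : E3 → ℝ} (hψ : ContDiff ℝ ∞ ψ)
    (hg : ContDiff ℝ ∞ g) (v : E3) (z : E3 × E3) :
    posDeriv v (tensorTest ψ g) z = tensorTest (fun x => fderiv ℝ ψ x v) g z := by
  have h1 : ContDiff ℝ 1 (tensorTest ψ g) := (contDiff_tensorTest hψ hg).of_le (by simp)
  have h2 : HasFDerivAt ψ (fderiv ℝ ψ z.1) z.1 :=
    ((hψ.differentiable (by simp)) z.1).hasFDerivAt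
  have h3 := ((Complex.conjCLE.toContinuousLinearMap.hasFDerivAt).comp z.1 h2).mul_const
    (g z.2 : ℂ)
  rw [← Prod.mk.eta (p := z), ← fderiv_slice_apply h1]
  have h4 : fderiv ℝ (fun x => tensorTest ψ g (x, z.2)) z.1 = _ := h3.fderiv
  rw [h4]
  simp [tensorTest, mul_comm]

theorem inner_testLp_tensorTest {φ : E3 × E3 → ℂ} (hφ : Continuous φ) (hc : HasCompactSupport φ)
    {ψ : E3 → ℂ} {g : E3 → ℝ} (hg : MemLp (fun q => (g q : ℂ)) 2 (volume : Measure E3))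
    (h : ∀ z, φ z = tensorTest ψ g z) (u : L2xq) (hi : Integrable fun x => ψ x • u x) :
    (inner ℂ (testLp φ hφ hc) u : ℂ) = inner ℂ (hg.toLp _ : L2q) (∫ x, ψ x • u x) := by
  rw [inner_testLp, ← innerSL_apply_apply, ← ContinuousLinearMap.integral_comp_comm _ hi]
  congr 1
  ext x
  have h1 : slice φ hφ hc x = (starRingEnd ℂ) (ψ x) • (hg.toLp _ : L2q) := by
    apply Lp.ext
    filter_upwards [slice_coeFn hφ hc x, Lp.coeFn_smul ((starRingEnd ℂ) (ψ x)) (hg.toLp _ : L2q),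
      hg.coeFn_toLp] with q h1 h2 h3
    rw [h1, h2, Pi.smul_apply, h3, h, tensorTest, smul_eq_mul]
  rw [h1, innerSL_apply_apply, inner_smul_left, inner_smul_right, Complex.conj_conj]

theorem integrable_bounded_smul {B : E3 → ℝ} (hB : MemLp B 2 volume) {ψ : E3 → ℂ}
    (hψ : Continuous ψ) (hψB : ∀ x, ‖ψ x‖ ≤ B x) (u : L2xq) : Integrable fun x => ψ x • u x := by
  have h1 : MemLp ψ 2 volume := hB.mono' hψ.aestronglyMeasurable (Eventually.of_forall hψB)
  have h : MemLp (fun x => ψ x • u x) 1 volume := MemLp.smul (Lp.memLp u) h1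
  exact memLp_one_iff_integrable.1 h

theorem integrable_compactSupport_smul {ψ : E3 → ℂ} (hψ : Continuous ψ)
    (hc : HasCompactSupport ψ) (u : L2xq) : Integrable fun x => ψ x • u x :=
  integrable_bounded_smul (hψ.memLp_of_hasCompactSupport hc).norm hψ (fun _ => le_rfl) u

/-- The weak relation `w = B Y`, tested against functions of `x`. -/
theorem integral_smul_eq_of_weakForm (β : ℝ) (hβ : 0 < β) {w Y : L2xq}
    (h : ∀ (φ : E3 × E3 → ℂ) (hφ : ContDiff ℝ ∞ φ) (hc : HasCompactSupport φ),
      (inner ℂ (testLp φ hφ.continuous hc) w : ℂ) = weakForm β hβ φ (hφ.of_le (by simp)) hc Y)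
    {ψ : E3 → ℂ} (hψ : ContDiff ℝ ∞ ψ) (hψc : HasCompactSupport ψ) :
    ∫ x, ψ x • w x
      = (∑ i : Fin 3, ∫ x, fderiv ℝ ψ x (EuclideanSpace.single i 1) •
          (velMul i).compLpL 2 volume Y x)
        + ∫ x, ψ x • (fiberGenerator β hβ 0).compLpL 2 volume Y x := by
  apply L2q_eq_of_integral_smul
  intro g hg hgc
  have hgm : MemLp (fun q => (g q : ℂ)) 2 (volume : Measure E3) :=
    Continuous.memLp_of_hasCompactSupport
      (Complex.continuous_ofReal.comp hg.continuous) (hgc.comp_left (g := Complex.ofReal) rfl)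
  have hpair : ∀ u : L2q, ∫ q, (g q : ℂ) * u q = inner ℂ (hgm.toLp _ : L2q) u := by
    intro u
    rw [L2.inner_def]
    apply integral_congr_ae
    filter_upwards [hgm.coeFn_toLp] with q hq
    rw [hq, RCLike.inner_apply, Complex.conj_ofReal, mul_comm]
  have hψ' : ∀ v, Continuous fun x => fderiv ℝ ψ x v := fun v =>
    (hψ.continuous_fderiv (by simp)).clm_apply continuous_const
  rw [hpair, hpair, inner_add_right, inner_sum]
  have h1 := h (tensorTest ψ g) (contDiff_tensorTest hψ hg) (hasCompactSupport_tensorTest hψc hgc)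
  rw [weakForm_apply] at h1
  rw [inner_testLp_tensorTest _ _ hgm (fun _ => rfl) w
    (integrable_compactSupport_smul hψ.continuous hψc w)] at h1
  rw [h1]
  congr 1
  · refine Finset.sum_congr rfl fun i _ => ?_
    rw [inner_testLp_tensorTest _ _ hgm (posDeriv_tensorTest hψ hg _) _
      (integrable_compactSupport_smul (hψ' _) (hψc.fderiv_apply ℝ _) _)]
  · rw [inner_testLp_tensorTest _ _ hgm (fun _ => rfl) _
      (integrable_compactSupport_smul hψ.continuous hψc _)]

theorem tendsto_integral_smul {B : E3 → ℝ} (hB : MemLp B 2 volume) {ψ : E3 → ℂ}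
    {ψs : ℕ → E3 → ℂ} (hψs : ∀ n, Continuous (ψs n)) (hψB : ∀ n x, ‖ψs n x‖ ≤ B x)
    (hlim : ∀ x, Tendsto (fun n => ψs n x) atTop (𝓝 (ψ x))) (u : L2xq) :
    Tendsto (fun n => ∫ x, ψs n x • u x) atTop (𝓝 (∫ x, ψ x • u x)) := by
  refine tendsto_integral_of_dominated_convergence (fun x => B x * ‖u x‖)
    (fun n => (hψs n).aestronglyMeasurable.smul (Lp.memLp u).1)
    (hB.integrable_mul (Lp.memLp u).norm) (fun n => Eventually.of_forall fun x => ?_)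
    (Eventually.of_forall fun x => (hlim x).smul_const _)
  rw [norm_smul]
  exact mul_le_mul_of_nonneg_right (hψB n x) (norm_nonneg _)

/-- Approximation of Schwartz functions by test functions, with control of first derivatives. -/
theorem exists_testFunction_approx (θ : 𝓢(E3, ℂ)) :
    ∃ (ψs : ℕ → E3 → ℂ) (B : E3 → ℝ), MemLp B 2 volume ∧ (∀ n, ContDiff ℝ ∞ (ψs n)) ∧
      (∀ n, HasCompactSupport (ψs n)) ∧ (∀ n x, ‖ψs n x‖ ≤ B x) ∧
      (∀ n x (i : Fin 3), ‖fderiv ℝ (ψs n) x (EuclideanSpace.single i 1)‖ ≤ B x) ∧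
      (∀ x, Tendsto (fun n => ψs n x) atTop (𝓝 (θ x))) ∧
      ∀ x (i : Fin 3), Tendsto (fun n => fderiv ℝ (ψs n) x (EuclideanSpace.single i 1)) atTop
        (𝓝 ((∂_{EuclideanSpace.single i (1 : ℝ)} θ) x)) := by
  -- The approximants are `χ(x / (n+1)) θ(x)`. The dilation costs the cutoff derivative a factor
  -- `(n+1)⁻¹ ≤ 1`, which both bounds the error term uniformly and sends it to zero.
  let χ : ContDiffBump (0 : E3) := ⟨1, 2, one_pos, one_lt_two⟩
  have hχ : ContDiff ℝ ∞ χ := χ.contDiff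
  have hχc : HasCompactSupport χ := χ.hasCompactSupport
  obtain ⟨C, hC⟩ := (hχ.continuous_fderiv (by simp)).bounded_above_of_compact_support
    (hχc.fderiv ℝ)
  have hC0 : 0 ≤ C := (norm_nonneg _).trans (hC 0)
  have hθ : ContDiff ℝ ∞ θ := θ.smooth ⊤
  set c : ℕ → ℝ := fun n => ((n : ℝ) + 1)⁻¹ with hc
  have hc0 : ∀ n, 0 < c n := fun n => by simp only [hc]; positivity
  have hc1 : ∀ n, c n ≤ 1 := fun n => inv_le_one_of_one_le₀ (by
    have : (0 : ℝ) ≤ n := Nat.cast_nonneg n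
    linarith)
  have hd : ∀ n x, HasFDerivAt (fun x => χ (c n • x)) (c n • fderiv ℝ χ (c n • x)) x := by
    intro n x
    have h1 : HasFDerivAt (fun x : E3 => c n • x) (c n • ContinuousLinearMap.id ℝ E3) x :=
      (hasFDerivAt_id x).const_smul (c n)
    have h2 := ((hχ.differentiable (by simp)) (c n • x)).hasFDerivAt.comp x h1
    convert! h2 using 1
    ext v
    simp
  have hdθ : ∀ x, HasFDerivAt θ (fderiv ℝ θ x) x := fun x =>
    ((hθ.differentiable (by simp)) x).hasFDerivAt
  have hdp : ∀ n x v, fderiv ℝ (fun x => χ (c n • x) • θ x) x v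
      = χ (c n • x) • fderiv ℝ θ x v + (c n * fderiv ℝ χ (c n • x) v) • θ x := by
    intro n x v
    have h3 : fderiv ℝ (fun x => χ (c n • x) • θ x) x = _ := ((hd n x).smul (hdθ x)).fderiv
    rw [h3]
    simp
  have hχlim : ∀ x : E3, ∀ᶠ n : ℕ in atTop, χ (c n • x) = 1 := by
    intro x
    obtain ⟨N, hN⟩ := exists_nat_ge ‖x‖
    filter_upwards [eventually_ge_atTop N] with n hn
    apply χ.one_of_mem_closedBall
    rw [mem_closedBall_zero_iff, norm_smul, Real.norm_of_nonneg (hc0 n).le]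
    simp only [hc]
    rw [inv_mul_le_iff₀ (by positivity)]
    have h3 : (N : ℝ) ≤ n := by exact_mod_cast hn
    change ‖x‖ ≤ ((n : ℝ) + 1) * 1
    linarith
  have hclim : Tendsto c atTop (𝓝 0) := by
    have := tendsto_one_div_add_atTop_nhds_zero_nat (𝕜 := ℝ)
    simpa [hc] using this
  refine ⟨fun n x => χ (c n • x) • θ x,
    fun x => (1 + C) * ‖θ x‖ + ∑ i : Fin 3, ‖(∂_{EuclideanSpace.single i (1 : ℝ)} θ) x‖,
    ?_, ?_, ?_, ?_, ?_, ?_, ?_⟩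
  · refine MemLp.add ((θ.memLp 2 volume).norm.const_mul _) (memLp_finsetSum _ fun i _ => ?_)
    exact ((∂_{EuclideanSpace.single i (1 : ℝ)} θ).memLp 2 volume).norm
  · intro n
    exact (hχ.comp (contDiff_const_smul (c n))).smul hθ
  · intro n
    have h4 : HasCompactSupport fun x => χ (c n • x) := hχc.comp_smul (hc0 n).ne'
    exact h4.smul_right
  · intro n x
    rw [norm_smul, Real.norm_of_nonneg χ.nonneg]
    have h5 : 0 ≤ ∑ i : Fin 3, ‖(∂_{EuclideanSpace.single i (1 : ℝ)} θ) x‖ :=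
      Finset.sum_nonneg fun _ _ => norm_nonneg _
    have h6 : χ (c n • x) * ‖θ x‖ ≤ 1 * ‖θ x‖ := by gcongr; exact χ.le_one
    nlinarith [mul_nonneg hC0 (norm_nonneg (θ x))]
  · intro n x i
    rw [hdp]
    refine (norm_add_le _ _).trans ?_
    rw [norm_smul, norm_smul, Real.norm_of_nonneg χ.nonneg, norm_mul,
      Real.norm_of_nonneg (hc0 n).le]
    have h7 : ‖fderiv ℝ θ x (EuclideanSpace.single i 1)‖
        ≤ ∑ i : Fin 3, ‖(∂_{EuclideanSpace.single i (1 : ℝ)} θ) x‖ := by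
      rw [← SchwartzMap.lineDerivOp_apply_eq_fderiv]
      exact Finset.single_le_sum
        (f := fun i : Fin 3 => ‖(∂_{EuclideanSpace.single i (1 : ℝ)} θ) x‖)
        (fun _ _ => norm_nonneg _) (Finset.mem_univ i)
    have h8 : ‖fderiv ℝ χ (c n • x) (EuclideanSpace.single i 1)‖ ≤ C := by
      refine ((fderiv ℝ χ (c n • x)).le_opNorm _).trans ?_
      rw [PiLp.norm_single, norm_one, mul_one]
      exact hC _
    have h9 : χ (c n • x) * ‖fderiv ℝ θ x (EuclideanSpace.single i 1)‖
        ≤ 1 * ‖fderiv ℝ θ x (EuclideanSpace.single i 1)‖ := by gcongr; exact χ.le_one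
    have h10 : c n * ‖fderiv ℝ χ (c n • x) (EuclideanSpace.single i 1)‖ * ‖θ x‖
        ≤ 1 * C * ‖θ x‖ := by gcongr; exact hc1 n
    nlinarith [norm_nonneg (θ x)]
  · intro x
    refine tendsto_const_nhds.congr' ?_
    filter_upwards [hχlim x] with n hn
    rw [hn, one_smul]
  · intro x i
    simp only [hdp]
    rw [SchwartzMap.lineDerivOp_apply_eq_fderiv]
    have h11 : Tendsto (fun n => c n * fderiv ℝ χ (c n • x) (EuclideanSpace.single i 1)) atTop
        (𝓝 0) := by
      refine squeeze_zero_norm (a := fun n => c n * C) (fun n => ?_) (by simpa using hclim.mul_const C)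
      rw [norm_mul, Real.norm_of_nonneg (hc0 n).le]
      refine mul_le_mul_of_nonneg_left ?_ (hc0 n).le
      refine ((fderiv ℝ χ (c n • x)).le_opNorm _).trans ?_
      rw [PiLp.norm_single, norm_one, mul_one]
      exact hC _
    have h12 := h11.smul_const (θ x)
    rw [zero_smul] at h12
    have h13 : Tendsto (fun n => χ (c n • x) • fderiv ℝ θ x (EuclideanSpace.single i 1)) atTop
        (𝓝 (fderiv ℝ θ x (EuclideanSpace.single i 1))) := by
      refine tendsto_const_nhds.congr' ?_
      filter_upwards [hχlim x] with n hn
      rw [hn, one_smul]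
    simpa using h13.add h12

/-- The extension beyond compact support is needed because the relation is applied to `𝓕 θ`, which
is Schwartz but in general not compactly supported. -/
theorem integral_schwartz_smul_eq_of_weakForm (β : ℝ) (hβ : 0 < β) {w Y : L2xq}
    (h : ∀ (φ : E3 × E3 → ℂ) (hφ : ContDiff ℝ ∞ φ) (hc : HasCompactSupport φ),
      (inner ℂ (testLp φ hφ.continuous hc) w : ℂ) = weakForm β hβ φ (hφ.of_le (by simp)) hc Y)
    (θ : 𝓢(E3, ℂ)) :
    ∫ x, θ x • w x
      = (∑ i : Fin 3, ∫ x, (∂_{EuclideanSpace.single i (1 : ℝ)} θ) x •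
          (velMul i).compLpL 2 volume Y x)
        + ∫ x, θ x • (fiberGenerator β hβ 0).compLpL 2 volume Y x := by
  obtain ⟨ψs, B, hB, hs, hc, hb, hb', hl, hl'⟩ := exists_testFunction_approx θ
  have hs' : ∀ n v, Continuous fun x => fderiv ℝ (ψs n) x v := fun n v =>
    ((hs n).continuous_fderiv (by simp)).clm_apply continuous_const
  have h1 := tendsto_integral_smul hB (fun n => (hs n).continuous) hb hl w
  have h2 := tendsto_integral_smul hB (fun n => (hs n).continuous) hb hl
    ((fiberGenerator β hβ 0).compLpL 2 volume Y)
  have h3 := fun i : Fin 3 => tendsto_integral_smul hB (fun n => hs' n (EuclideanSpace.single i 1))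
    (fun n x => hb' n x i) (fun x => hl' x i) ((velMul i).compLpL 2 volume Y)
  have h4 := (tendsto_finsetSum Finset.univ fun i _ => h3 i).add h2
  refine tendsto_nhds_unique h1 (h4.congr fun n => ?_)
  exact (integral_smul_eq_of_weakForm β hβ h (hs n) (hc n)).symm

/-- Test with smooth compactly supported functions of `ξ`, whose transforms are admissible by
`integral_schwartz_smul_eq_of_weakForm`; derivatives of these transforms become factors `ξᵢ`. The
right-hand side is a priori only locally integrable, which suffices for almost everywhere equality.
-/
theorem fourier_eq_fiberGenerator_of_weakForm (β : ℝ) (hβ : 0 < β) {w Y : L2xq}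
    (h : ∀ (φ : E3 × E3 → ℂ) (hφ : ContDiff ℝ ∞ φ) (hc : HasCompactSupport φ),
      (inner ℂ (testLp φ hφ.continuous hc) w : ℂ) = weakForm β hβ φ (hφ.of_le (by simp)) hc Y) :
    ((𝓕 w : L2xq) : E3 → L2q) =ᵐ[volume]
      fun ξ => fiberGenerator β hβ ((2 * Real.pi) • ξ) ((𝓕 Y : L2xq) ξ) := by
  set Q : Fin 3 → L2xq := fun i => (velMul i).compLpL 2 volume (𝓕 Y : L2xq) with hQ
  set M : L2xq := (fiberGenerator β hβ 0).compLpL 2 volume (𝓕 Y : L2xq) with hM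
  set m : Fin 3 → E3 → ℂ := fun i ξ => -(2 * Real.pi * Complex.I) * (ξ i : ℝ) with hm
  have hmc : ∀ i, Continuous (m i) := fun i => by
    simp only [hm]
    fun_prop
  have hG : (fun ξ => fiberGenerator β hβ ((2 * Real.pi) • ξ) ((𝓕 Y : L2xq) ξ))
      =ᵐ[volume] fun ξ => (∑ i, m i ξ • Q i ξ) + M ξ := by
    have hae : ∀ᵐ ξ : E3, ∀ i, Q i ξ = velMul i ((𝓕 Y : L2xq) ξ) :=
      ae_all_iff.2 fun i => (velMul i).coeFn_compLpL _
    filter_upwards [hae, (fiberGenerator β hβ 0).coeFn_compLpL (𝓕 Y : L2xq)] with ξ h1 h2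
    rw [hM, h2, fiberGenerator_eq, sub_apply, sum_apply, sub_eq_neg_add, ← Finset.sum_neg_distrib]
    congr 1
    refine Finset.sum_congr rfl fun i _ => ?_
    rw [h1 i, smul_apply, ← neg_smul]
    congr 1
    simp only [hm, PiLp.smul_apply, smul_eq_mul]
    push_cast
    ring
  refine EventuallyEq.trans ?_ hG.symm
  have hlocQ : ∀ i, LocallyIntegrable (fun ξ => m i ξ • Q i ξ) volume := by
    intro i
    have hl : LocallyIntegrable (Q i) volume := (Lp.memLp _).locallyIntegrable (by norm_num)
    rw [← locallyIntegrableOn_univ] at hl ⊢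
    exact hl.continuousOn_smul isOpen_univ.isLocallyClosed (hmc i).continuousOn
  have hlocM : LocallyIntegrable M volume := (Lp.memLp _).locallyIntegrable (by norm_num)
  have hloc : LocallyIntegrable (fun ξ => (∑ i, m i ξ • Q i ξ) + M ξ) volume :=
    (locallyIntegrable_finsetSum _ fun i _ => hlocQ i).add hlocM
  refine ae_eq_of_integral_contDiff_smul_eq ((Lp.memLp _).locallyIntegrable (by norm_num)) hloc
    fun g hg hgc => ?_
  have hg1 : HasCompactSupport (Complex.ofRealCLM ∘ g) := hgc.comp_left rfl
  have hg2 : ContDiff ℝ ∞ (Complex.ofRealCLM ∘ g) := by fun_prop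
  set θ : 𝓢(E3, ℂ) := hg1.toSchwartzMap hg2 with hθ
  have hθg : ∀ ξ, θ ξ = (g ξ : ℂ) := fun ξ => rfl
  have hl : ∀ (u : E3 → L2q), ∫ ξ, g ξ • u ξ = ∫ ξ, θ ξ • u ξ := fun u => by
    refine integral_congr_ae (Eventually.of_forall fun ξ => ?_)
    exact RCLike.real_smul_eq_coe_smul (K := ℂ) _ _
  rw [hl, hl, integral_smul_fourier, integral_schwartz_smul_eq_of_weakForm β hβ h]
  have hD : ∀ (i : Fin 3) (ξ : E3), (-(2 * Real.pi * Complex.I) •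
      SchwartzMap.smulLeftCLM ℂ (fun y : E3 => inner ℝ y (EuclideanSpace.single i (1 : ℝ))) θ) ξ
      = θ ξ * m i ξ := by
    intro i ξ
    have htg : (fun y : E3 =>
      inner ℝ y (EuclideanSpace.single i (1 : ℝ))).HasTemperateGrowth := by fun_prop
    rw [smul_apply, SchwartzMap.smulLeftCLM_apply_apply htg, EuclideanSpace.inner_single_right]
    simp only [hm, smul_eq_mul, Complex.real_smul, one_mul, conj_trivial]
    ring
  have h1 : ∀ i : Fin 3, ∫ x, (∂_{EuclideanSpace.single i (1 : ℝ)} (𝓕 θ)) x •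
      (velMul i).compLpL 2 volume Y x = ∫ ξ, (θ ξ * m i ξ) • Q i ξ := by
    intro i
    rw [SchwartzMap.lineDerivOp_fourier_eq, ← integral_smul_fourier, fourier_compLpL]
    simp only [hD]
    rfl
  have h2 : ∫ x, (𝓕 θ) x • (fiberGenerator β hβ 0).compLpL 2 volume Y x = ∫ ξ, θ ξ • M ξ := by
    rw [← integral_smul_fourier, fourier_compLpL]
  have hi : ∀ i, Integrable fun ξ => (θ ξ * m i ξ) • Q i ξ := by
    intro i
    simp only [← hD]
    exact integrable_schwartz_smul _ _
  rw [h2, Finset.sum_congr rfl fun i _ => h1 i, ← integral_finsetSum _ fun i _ => hi i,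
    ← integral_add (integrable_finsetSum _ fun i _ => hi i) (integrable_schwartz_smul θ M)]
  refine integral_congr_ae (Eventually.of_forall fun ξ => ?_)
  simp only [smul_add, Finset.smul_sum, smul_smul]

theorem norm_restrict_le {f g : L2xq} {C : ℝ} {s : Set E3} (hs : MeasurableSet s)
    (h : ∀ᵐ ξ : E3, ξ ∈ s → ‖f ξ‖ ≤ C * ‖g ξ‖) :
    ‖LpToLpRestrictCLM E3 L2q ℂ volume 2 s f‖
      ≤ C * ‖LpToLpRestrictCLM E3 L2q ℂ volume 2 s g‖ := by
  apply Lp.norm_le_mul_norm_of_ae_le_mul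
  filter_upwards [LpToLpRestrictCLM_coeFn ℂ s f, LpToLpRestrictCLM_coeFn ℂ s g,
    ae_restrict_of_ae h, ae_restrict_mem hs] with ξ h1 h2 h3 h4
  rw [h1, h2]
  exact h3 h4

/-- Weak solutions are unique. -/
theorem IsWeakSolution.unique {β : ℝ} (hβ : 0 < β) {f₀ : L2xq} {f g : ℝ → L2xq}
    (hf : IsWeakSolution β f₀ f) (hg : IsWeakSolution β f₀ g) {t : ℝ} (ht : 0 ≤ t) :
    g t = f t := by
  rw [isWeakSolution_iff β hβ] at hf hg
  set w : ℝ → L2xq := fun s => g s - f s with hw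
  have hwi : ∀ T, IntegrableOn w (Set.Icc 0 T) := by
    intro T
    rcases lt_or_ge 0 T with hT | hT
    · exact (hg.1 T hT).sub (hf.1 T hT)
    · exact ((hg.1 1 one_pos).sub (hf.1 1 one_pos)).mono_set
        (Set.Icc_subset_Icc_right (hT.trans zero_le_one))
  have hii : ∀ (u : ℝ → L2xq), (∀ T : ℝ, 0 < T → IntegrableOn u (Set.Icc 0 T)) → ∀ s, 0 ≤ s →
      IntervalIntegrable u volume 0 s := by
    intro u hu s hs
    rw [intervalIntegrable_iff_integrableOn_Ioc_of_le hs]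
    exact (hu (s + 1) (by linarith)).mono_set fun r hr => ⟨hr.1.le, hr.2.trans (by linarith)⟩
  set Y : ℝ → L2xq := fun s => ∫ r in (0 : ℝ)..s, w r with hY
  -- Valid at every time, not merely almost every time, because the weak formulation is imposed for
  -- all `t ≥ 0`; this is what yields equality of the solutions for all `t`.
  have hrel : ∀ s, 0 ≤ s → ((𝓕 (w s) : L2xq) : E3 → L2q) =ᵐ[volume]
      fun ξ => fiberGenerator β hβ ((2 * Real.pi) • ξ) ((𝓕 (Y s) : L2xq) ξ) := by
    intro s hs
    apply fourier_eq_fiberGenerator_of_weakForm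
    intro φ hφ hc
    set Λ := weakForm β hβ φ (hφ.of_le (by simp)) hc with hΛ
    have hfi := hii f hf.1 s hs
    have hgi := hii g hg.1 s hs
    have h1 : ∀ u : ℝ → L2xq, IntervalIntegrable u volume 0 s →
        ∫ r in (0 : ℝ)..s, Λ (u r) = Λ (∫ r in (0 : ℝ)..s, u r) := fun u hu =>
      ContinuousLinearMap.intervalIntegral_comp_comm Λ hu
    simp only [hY, hw]
    rw [intervalIntegral.integral_sub hgi hfi, map_sub, inner_sub_right, hf.2 φ hφ hc s hs,
      hg.2 φ hφ hc s hs, h1 f hfi, h1 g hgi]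
    ring
  have hYzero : ((𝓕 (Y t) : L2xq) : E3 → L2q) =ᵐ[volume] 0 := by
    -- The generators are not uniformly bounded over all frequencies, so Gronwall is run on each
    -- ball, with a constant depending on `n`; countably many balls exhaust the space.
    have hball : ∀ n : ℕ, ∀ᵐ ξ : E3, ξ ∈ Metric.closedBall (0 : E3) n → (𝓕 (Y t) : L2xq) ξ = 0 := by
      intro n
      have hG : Continuous fun ξ : E3 => fiberGenerator β hβ ((2 * Real.pi) • ξ) :=
        (continuous_fiberGenerator β hβ).comp (continuous_const_smul _)
      obtain ⟨C, hC⟩ := (isCompact_closedBall (0 : E3) n).exists_bound_of_continuousOn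
        hG.continuousOn
      have hms : MeasurableSet (Metric.closedBall (0 : E3) n) := measurableSet_closedBall
      set A : L2xq →L[ℂ] Lp L2q 2 ((volume : Measure E3).restrict (Metric.closedBall 0 n)) :=
        (LpToLpRestrictCLM E3 L2q ℂ volume 2 (Metric.closedBall (0 : E3) n)).comp
          (Lp.fourierTransformₗᵢ E3 L2q).toContinuousLinearEquiv.toContinuousLinearMap with hA
      have hAu : ∀ u, A u = LpToLpRestrictCLM E3 L2q ℂ volume 2 (Metric.closedBall (0 : E3) n)
          (𝓕 u : L2xq) := fun u => rfl
      have hz : A (Y t) = 0 := map_integral_eq_zero A (hwi t) (C := C) (fun s hs => by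
        rw [hAu, hAu]
        apply norm_restrict_le hms
        filter_upwards [hrel s hs.1] with ξ h1 h2
        rw [h1]
        exact (ContinuousLinearMap.le_opNorm _ _).trans
          (mul_le_mul_of_nonneg_right (hC ξ h2) (norm_nonneg _))) t ⟨ht, le_rfl⟩
      rw [hAu] at hz
      have h3 := LpToLpRestrictCLM_coeFn ℂ (Metric.closedBall (0 : E3) n) (𝓕 (Y t) : L2xq)
      rw [hz] at h3
      rw [← ae_restrict_iff' hms]
      filter_upwards [h3, Lp.coeFn_zero L2q 2
        ((volume : Measure E3).restrict (Metric.closedBall 0 n))] with ξ h4 h5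
      rw [← h4, h5, Pi.zero_apply]
    rw [← ae_all_iff] at hball
    filter_upwards [hball] with ξ hξ
    obtain ⟨n, hn⟩ := exists_nat_ge ‖ξ‖
    exact hξ n (mem_closedBall_zero_iff.2 hn)
  have hwt : (𝓕 (w t) : L2xq) = 0 := by
    apply Lp.ext
    filter_upwards [hrel t ht, hYzero, Lp.coeFn_zero L2q 2 (volume : Measure E3)] with ξ h1 h2 h3
    rw [h1, h2, h3, Pi.zero_apply, map_zero]
  have hwt' : w t = 0 := (Lp.fourierTransformₗᵢ E3 L2q).map_eq_zero_iff.1 hwt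
  exact sub_eq_zero.1 hwt'

/-! ### The partial Fourier transform and the norms of `H_l` -/

/-- Dilations preserve null sets; this transports almost everywhere statements between the variables
`ξ` and `ζ = 2πξ`. -/
theorem ae_comp_smul {p : E3 → Prop} {c : ℝ} (hc : c ≠ 0) (h : ∀ᵐ ξ : E3, p ξ) :
    ∀ᵐ ζ : E3, p (c • ζ) := by
  have hq : Measure.QuasiMeasurePreserving (fun ζ : E3 => c • ζ) volume volume := by
    refine ⟨measurable_const_smul c, ?_⟩
    rw [Measure.map_addHaar_smul _ hc]
    exact Measure.smul_absolutelyContinuous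
  exact hq.ae h

theorem two_pi_inv_ne_zero : (2 * Real.pi)⁻¹ ≠ 0 :=
  inv_ne_zero (mul_ne_zero two_ne_zero Real.pi_ne_zero)

theorem stronglyMeasurable_partialFourier (f : L2xq) : StronglyMeasurable (partialFourier f) := by
  have h := (Lp.stronglyMeasurable (𝓕 f : L2xq)).comp_measurable
    (measurable_const_smul (2 * Real.pi)⁻¹)
  exact h.const_smul (((2 * Real.pi) ^ (-(3 / 2 : ℝ)) : ℝ) : ℂ)

theorem partialFourier_sub (f g : L2xq) :
    partialFourier (f - g) =ᵐ[volume] fun ζ => partialFourier f ζ - partialFourier g ζ := by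
  have hF : (𝓕 (f - g) : L2xq) = 𝓕 f - 𝓕 g := (Lp.fourierTransformₗᵢ E3 L2q).map_sub f g
  filter_upwards [ae_comp_smul two_pi_inv_ne_zero (Lp.coeFn_sub (𝓕 f : L2xq) (𝓕 g : L2xq))]
    with ζ hζ
  rw [partialFourier, hF, hζ, Pi.sub_apply, smul_sub, partialFourier, partialFourier]

theorem partialFourier_evol (β : ℝ) (hβ : 0 < β) (f₀ : L2xq) (t : ℝ) :
    partialFourier (evol β hβ f₀ t) =ᵐ[volume]
      fun ζ => propagator β hβ t ζ (partialFourier f₀ ζ) := by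
  filter_upwards [ae_comp_smul two_pi_inv_ne_zero (evolHat_coeFn β hβ (𝓕 f₀ : L2xq) t)] with ζ hζ
  rw [partialFourier, fourier_evol, hζ, smul_smul,
    mul_inv_cancel₀ (mul_ne_zero two_ne_zero Real.pi_ne_zero), one_smul, partialFourier, map_smul]

/-- The contraction holds frequency by frequency, so it survives any weight in `ζ`, whatever the
sign of `l`. -/
theorem HlNorm_evol_le (β : ℝ) (hβ : 0 < β) (l : ℝ) (f₀ : L2xq) (t : ℝ) :
    HlNorm l (evol β hβ f₀ t) ≤ HlNorm l f₀ := by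
  apply eLpNorm_mono_ae
  filter_upwards [partialFourier_evol β hβ f₀ t] with ζ hζ
  rw [hζ, norm_mul, norm_mul, norm_norm, norm_norm]
  exact mul_le_mul_of_nonneg_left (norm_propagator_apply_le hβ _ _ _) (norm_nonneg _)

theorem tendsto_HlNorm_evol_sub (β : ℝ) (hβ : 0 < β) {l : ℝ} {f₀ : L2xq} (hf₀ : MemHl l f₀)
    (t₀ : ℝ) : Tendsto (fun t => HlNorm l (evol β hβ f₀ t - evol β hβ f₀ t₀)) (𝓝 t₀) (𝓝 0) := by
  have hw : Continuous fun ζ : E3 => (1 + ‖ζ‖ ^ 2) ^ (l / 2) := by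
    refine Continuous.rpow_const (by fun_prop) fun ζ => Or.inl ?_
    positivity
  refine (tendsto_eLpNorm_propagator hβ 1 (stronglyMeasurable_partialFourier f₀) hw hf₀
    t₀).congr fun t => ?_
  apply eLpNorm_congr_ae
  filter_upwards [partialFourier_sub (evol β hβ f₀ t) (evol β hβ f₀ t₀),
    partialFourier_evol β hβ f₀ t, partialFourier_evol β hβ f₀ t₀] with ζ h1 h2 h3
  rw [h1, h2, h3, one_smul]

/-! ### Complex conjugation -/

/-- Complex conjugation on `L²(ℝ³_q)`. -/
noncomputable def conjL2q : L2q →L[ℝ] L2q :=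
  Complex.conjCLE.toContinuousLinearMap.compLpL 2 volume

/-- Complex conjugation on `L²(ℝ³_x × ℝ³_q)`. -/
noncomputable def conjL2xq : L2xq →L[ℝ] L2xq := conjL2q.compLpL 2 volume

theorem conjL2q_coeFn (u : L2q) :
    (conjL2q u : E3 → ℂ) =ᵐ[volume] fun q => (starRingEnd ℂ) (u q) :=
  Complex.conjCLE.toContinuousLinearMap.coeFn_compLpL u

theorem conjL2xq_coeFn (f : L2xq) :
    (conjL2xq f : E3 → L2q) =ᵐ[volume] fun x => conjL2q (f x) :=
  conjL2q.coeFn_compLpL f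

theorem linL_congr (β : ℝ) {u v : E3 → ℂ} (h : u =ᵐ[volume] v) : linL β u =ᵐ[volume] linL β v := by
  have hint : ∀ a : E3 → ℂ, ∫ p, a p * u p = ∫ p, a p * v p := fun a =>
    integral_congr_ae (h.mono fun p hp => by simp only [hp])
  filter_upwards [h] with q hq
  simp only [linL, projP, hint, hq]

theorem linL_conj (β : ℝ) (u : E3 → ℂ) (q : E3) :
    linL β (fun q => (starRingEnd ℂ) (u q)) q = (starRingEnd ℂ) (linL β u q) := by
  have hint : ∀ a : E3 → ℝ, ∫ p, (a p : ℂ) * (starRingEnd ℂ) (u p)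
      = (starRingEnd ℂ) (∫ p, (a p : ℂ) * u p) := by
    intro a
    rw [← integral_conj]
    simp
  simp only [linL, projP, hint, map_div₀, map_sub, map_mul, map_add, map_sum, Complex.conj_ofReal]

/-- Two independent functions are allowed so that one identity serves both pairings in the weak
formulation: `φ₂ = 0` gives the plain one. -/
theorem integral_conjL2xq (β : ℝ) (f : L2xq) (φ₁ φ₂ : E3 × E3 → ℂ) :
    ∫ x, ∫ q, (conjL2xq f x q * φ₁ (x, q) + linL β (conjL2xq f x) q * φ₂ (x, q))
      = (starRingEnd ℂ) (∫ x, ∫ q, (f x q * conjTest φ₁ (x, q)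
        + linL β (f x) q * conjTest φ₂ (x, q))) := by
  rw [← integral_conj]
  apply integral_congr_ae
  filter_upwards [conjL2xq_coeFn f] with x hx
  rw [hx, ← integral_conj]
  apply integral_congr_ae
  filter_upwards [conjL2q_coeFn (f x), linL_congr β (conjL2q_coeFn (f x))] with q h1 h2
  rw [h1, h2, linL_conj]
  simp [conjTest]

/-- Both `q̂` and the kernel of `L` are real; testing the conjugate against `φ` amounts to testing
`f` against the conjugate of `φ`. -/
theorem IsWeakSolution.conj {β : ℝ} {f₀ : L2xq} {f : ℝ → L2xq} (hf : IsWeakSolution β f₀ f) :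
    IsWeakSolution β (conjL2xq f₀) fun t => conjL2xq (f t) := by
  refine ⟨fun T hT => conjL2xq.integrable_comp (hf.1 T hT), fun φ hφ hc t ht => ?_⟩
  have h0 : ∀ u : L2xq, ∫ x, ∫ q, conjL2xq u x q * φ (x, q)
      = (starRingEnd ℂ) (∫ x, ∫ q, u x q * conjTest φ (x, q)) := by
    intro u
    have := integral_conjL2xq β u φ 0
    simpa [conjTest] using this
  have hφ1 : ContDiff ℝ 1 φ := hφ.of_le (by simp)
  have h1 : ∀ u : L2xq, ∫ x, ∫ q, (conjL2xq u x q * fderiv ℝ φ (x, q) (velocity q, 0)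
      + linL β (conjL2xq u x) q * φ (x, q))
      = (starRingEnd ℂ) (∫ x, ∫ q, (u x q * fderiv ℝ (conjTest φ) (x, q) (velocity q, 0)
        + linL β (u x) q * conjTest φ (x, q))) := by
    intro u
    have := integral_conjL2xq β u (fun z => fderiv ℝ φ z (velocity z.2, 0)) φ
    simpa only [conjTest, fderiv_conjTest hφ1] using this
  have h2 := hf.2 (conjTest φ) (contDiff_conjTest hφ) (hasCompactSupport_conjTest hc) t ht
  simp only [h0, h1]
  rw [h2, map_add, intervalIntegral.integral_of_le ht, intervalIntegral.integral_of_le ht,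
    integral_conj]

theorem conjL2xq_eq_self_iff (f : L2xq) :
    conjL2xq f = f ↔ ∀ᵐ x : E3, ∀ᵐ q : E3, (f x q).im = 0 := by
  constructor
  · intro h
    have h1 := conjL2xq_coeFn f
    rw [h] at h1
    filter_upwards [h1] with x hx
    have h2 := conjL2q_coeFn (f x)
    rw [← hx] at h2
    filter_upwards [h2] with q hq
    exact Complex.conj_eq_iff_im.1 hq.symm
  · intro h
    apply Lp.ext
    filter_upwards [conjL2xq_coeFn f, h] with x hx h1
    rw [hx]
    apply Lp.ext
    filter_upwards [conjL2q_coeFn (f x), h1] with q hq h2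
    rw [hq]
    exact Complex.conj_eq_iff_im.2 h2

end RelBGK

theorem mainTheorem3 (β : ℝ) (hβ : 0 < β) (l : ℝ) (hl : 0 ≤ l)
    (f₀ : RelBGK.L2xq) (hf₀ : RelBGK.MemHl l f₀) :
    ∃ f : ℝ → RelBGK.L2xq,
      -- `f` is a global weak solution with initial datum `f₀`
      RelBGK.IsWeakSolution β f₀ f ∧
      -- it is the only one
      (∀ g : ℝ → RelBGK.L2xq, RelBGK.IsWeakSolution β f₀ g → ∀ t : ℝ, 0 ≤ t → g t = f t) ∧
      -- `f(t) ∈ H_l` and `‖f(t)‖_l ≤ ‖f₀‖_l`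
      (∀ t : ℝ, 0 ≤ t → RelBGK.MemHl l (f t) ∧ RelBGK.HlNorm l (f t) ≤ RelBGK.HlNorm l f₀) ∧
      -- `t ↦ f(t)` is continuous from `[0, ∞)` to `H_l`
      (∀ t₀ : ℝ, 0 ≤ t₀ →
        Tendsto (fun t : ℝ => RelBGK.HlNorm l (f t - f t₀)) (𝓝[Set.Ici 0] t₀) (𝓝 0)) ∧
      -- `f̂(t, ζ, ·) = exp(t B̂(ζ)) f̂₀(ζ, ·)`, and this does not increase the `L²(ℝ³_q)` norm
      (∀ t : ℝ, 0 ≤ t → ∀ᵐ ζ : RelBGK.E3,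
        RelBGK.partialFourier (f t) ζ =
            NormedSpace.exp ((t : ℂ) • RelBGK.fiberGenerator β hβ ζ)
              (RelBGK.partialFourier f₀ ζ) ∧
          ‖RelBGK.partialFourier (f t) ζ‖ ≤ ‖RelBGK.partialFourier f₀ ζ‖) ∧
      -- real-valued data give real-valued solutions
      ((∀ᵐ x : RelBGK.E3, ∀ᵐ q : RelBGK.E3, (f₀ x q).im = 0) →
        ∀ t : ℝ, 0 ≤ t → ∀ᵐ x : RelBGK.E3, ∀ᵐ q : RelBGK.E3, (f t x q).im = 0) := by
  have hsol := RelBGK.isWeakSolution_evol β hβ f₀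
  refine ⟨RelBGK.evol β hβ f₀, hsol, fun g hg t ht => hsol.unique hβ hg ht, fun t _ => ?_,
    fun t₀ _ => ?_, fun t ht => ?_, fun hreal t ht => ?_⟩
  · have h := RelBGK.HlNorm_evol_le β hβ l f₀ t
    exact ⟨h.trans_lt hf₀, h⟩
  · exact (RelBGK.tendsto_HlNorm_evol_sub β hβ hf₀ t₀).mono_left nhdsWithin_le_nhds
  · filter_upwards [RelBGK.partialFourier_evol β hβ f₀ t] with ζ hζ
    refine ⟨by rw [hζ, RelBGK.propagator_of_nonneg β hβ ht], ?_⟩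
    rw [hζ]
    exact RelBGK.norm_propagator_apply_le hβ _ _ _
  -- For real data the conjugate of the solution is a weak solution with the same datum, so
  -- uniqueness identifies the two.
  · rw [← RelBGK.conjL2xq_eq_self_iff] at hreal ⊢
    have hconj := hsol.conj
    rw [hreal] at hconj
    exact hsol.unique hβ hconj ht
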